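/- Let $\mathbb D$ be the open unit disc and let $\mathcal A(\mathbb D^2)$ be the bidisc algebra, that is, the completion in the supremum norm over $\overline{\mathbb D}^2$ of the algebra of functions holomorphic in a neighbourhood of $\overline{\mathbb D}^2$. A Hilbert module over $\mathcal A(\mathbb D^2)$ is a complex Hilbert space $\mathcal M$ with a unital module action $(f,h)\mapsto f\cdot h$ of $\mathcal A(\mathbb D^2)$ such that $\|f\cdot h\|\le C\|f\|_\infty\|h\|$ for some constant $C$ independent of $f$ and $h$. Two Hilbert modules are isomorphic if there is a unitary module map from one onto the other. Let Möb be the group of biholomorphic automorphisms $z\mapsto e^{i\theta}\frac{z-\alpha}{1-\bar\alpha z}$ ($\alpha\in\mathbb D$, $\theta\in[0,2\pi)$) of $\mathbb D$. For $\varphi=(\varphi_1,\varphi_2)\in$ Möb$\times$Möb, acting on $\overline{\mathbb D}^2$ coordinatewise, let $\varphi_*\mathcal M$ be the Hilbert space $\mathcal M$ with the module action $(f,h)\mapsto (f\circ\varphi)\cdot h$; $\mathcal M$ is called homogeneous if $\varphi_*\mathcal M$ is isomorphic to $\mathcal M$ for every $\varphi\in$ Möb$\times$Möb. The module $\mathcal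 M$ is in the Cowen–Douglas class $\mathrm B_1(\mathbb D^2)$ if, with $T_i$ the adjoint of the operator $h\mapsto z_i\cdot h$ ($i=1,2$) and $D_{T-w}:\mathcal M\to\mathcal M\oplus\mathcal M$, $D_{T-w}h=((T_1-w_1)h,(T_2-w_2)h)$, the following hold: $D_{T-w}$ has closed range for all $w\in\mathbb D^2$; the linear span of $\bigcup_{w\in\mathbb D^2}\ker D_{T-w}$ is dense in $\mathcal M$; and $\dim\ker D_{T-w}=1$ for all $w\in\mathbb D^2$. For $\lambda,\mu>0$ let $\mathcal M^{(\lambda,\mu)}$ be the Hilbert space of holomorphic functions on $\mathbb D^2$ with reproducing kernel $K^{(\lambda,\mu)}(z,w)=(1-z_1\bar w_1)^{-\lambda}(1-z_2\bar w_2)^{-\mu}$ (principal branches). Theorem. Let $\mathcal M$ be a homogeneous Hilbert module over $\mathcal A(\mathbb D^2)$ that is in the class $\mathrm B_1(\mathbb D^2)$. Then $\mathcal M$ is isomorphic to $\mathcal M^{(\lambda,\mu)}$ for some $\lambda,\mu>0$: there is a unitary operator $U:\mathcal M\to\mathcal M^{(\lambda,\mu)}$ such that $(U(f\cdot h))(z)=f(z)\,(Uh)(z)$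 for all $f\in\mathcal A(\mathbb D^2)$, $h\in\mathcal M$ and $z\in\mathbb D^2$. -/

import Mathlib

open scoped ComplexConjugate NNReal

noncomputable section

namespace Bidisc

/-- The open bidisc `𝔻²`. -/
abbrev openBidisc : Set (ℂ × ℂ) := Metric.ball 0 1 ×ˢ Metric.ball 0 1

/-- The closed bidisc, the closure of `𝔻²`. -/
abbrev closedBidisc : Set (ℂ × ℂ) := Metric.closedBall 0 1 ×ˢ Metric.closedBall 0 1

instance : CompactSpace closedBidisc :=
  isCompact_iff_compactSpace.mp
    ((isCompact_closedBall (0 : ℂ) 1).prod (isCompact_closedBall (0 : ℂ) 1))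

/-! ### The bidisc algebra -/

/-- Restrictions to the closed bidisc of functions that are holomorphic in a neighbourhood
of the closed bidisc. -/
def holomorphicNhd : Subalgebra ℂ C(closedBidisc, ℂ) where
  carrier := {f | ∃ U : Set (ℂ × ℂ), IsOpen U ∧ closedBidisc ⊆ U ∧
    ∃ F : ℂ × ℂ → ℂ, DifferentiableOn ℂ F U ∧ ∀ z : closedBidisc, f z = F z}
  mul_mem' := by
    rintro f g ⟨U, hU, hKU, F, hF, hfF⟩ ⟨V, hV, hKV, G, hG, hgG⟩
    exact ⟨U ∩ V, hU.inter hV, Set.subset_inter hKU hKV, fun z => F z * G z,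
      (hF.mono Set.inter_subset_left).mul (hG.mono Set.inter_subset_right),
      fun z => by simp [hfF, hgG]⟩
  add_mem' := by
    rintro f g ⟨U, hU, hKU, F, hF, hfF⟩ ⟨V, hV, hKV, G, hG, hgG⟩
    exact ⟨U ∩ V, hU.inter hV, Set.subset_inter hKU hKV, fun z => F z + G z,
      (hF.mono Set.inter_subset_left).add (hG.mono Set.inter_subset_right),
      fun z => by simp [hfF, hgG]⟩
  algebraMap_mem' := fun c =>
    ⟨Set.univ, isOpen_univ, Set.subset_univ _, fun _ => c, differentiableOn_const c,
      fun _ => rfl⟩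

/-- The bidisc algebra `𝒜(𝔻²)`: the completion in the supremum norm over the closed bidisc of
the algebra of functions holomorphic in a neighbourhood of the closed bidisc. -/
def algebra : Subalgebra ℂ C(closedBidisc, ℂ) := holomorphicNhd.topologicalClosure

/-- The coordinate function `z₁`. -/
def coord₁ : algebra :=
  ⟨⟨fun z => (z : ℂ × ℂ).1, by fun_prop⟩, holomorphicNhd.le_topologicalClosure
    ⟨Set.univ, isOpen_univ, Set.subset_univ _, Prod.fst, differentiable_fst.differentiableOn,
      fun _ => rfl⟩⟩

/-- The coordinate function `z₂`. -/
def coord₂ : algebra :=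
  ⟨⟨fun z => (z : ℂ × ℂ).2, by fun_prop⟩, holomorphicNhd.le_topologicalClosure
    ⟨Set.univ, isOpen_univ, Set.subset_univ _, Prod.snd, differentiable_snd.differentiableOn,
      fun _ => rfl⟩⟩

/-- The inclusion of the open bidisc in the closed bidisc. -/
def incl (z : openBidisc) : closedBidisc :=
  ⟨z, Metric.ball_subset_closedBall z.2.1, Metric.ball_subset_closedBall z.2.2⟩

/-! ### The Möbius group and its action on the bidisc algebra -/

/-- The parameters `(α, e^{iθ})`, `|α| < 1`, of the elements
`φ_{α,θ}(z) = e^{iθ} (z - α) / (1 - ᾱ z)` of the group Möb of biholomorphic automorphisms of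
the unit disc. -/
structure Mob where
  /-- the point `α` of the open unit disc -/
  center : ℂ
  center_lt : ‖center‖ < 1
  /-- the unimodular number `e^{iθ}` -/
  rot : Circle

/-- The map `φ_{α,θ}`. -/
def Mob.toFun (φ : Mob) (z : ℂ) : ℂ :=
  φ.rot * ((z - φ.center) / (1 - conj φ.center * z))

lemma Mob.denom_ne_zero (φ : Mob) {z : ℂ} (hz : ‖z‖ ≤ 1) : 1 - conj φ.center * z ≠ 0 := by
  intro h
  have h1 : conj φ.center * z = 1 := (sub_eq_zero.mp h).symm
  have h2 : ‖φ.center‖ * ‖z‖ = 1 := by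
    have := congrArg norm h1
    simpa using this
  nlinarith [norm_nonneg φ.center, norm_nonneg z, φ.center_lt]

lemma Mob.norm_toFun_le (φ : Mob) {z : ℂ} (hz : ‖z‖ ≤ 1) : ‖φ.toFun z‖ ≤ 1 := by
  have hd : 0 < ‖1 - conj φ.center * z‖ := norm_pos_iff.mpr (φ.denom_ne_zero hz)
  rw [Mob.toFun, norm_mul, Circle.norm_coe, one_mul, norm_div, div_le_one hd]
  refine le_of_sq_le_sq ?_ hd.le
  have hz2 : Complex.normSq z ≤ 1 := by
    rw [Complex.normSq_eq_norm_sq]; nlinarith [norm_nonneg z]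
  have ha2 : Complex.normSq φ.center ≤ 1 := by
    rw [Complex.normSq_eq_norm_sq]; nlinarith [norm_nonneg φ.center, φ.center_lt]
  rw [← Complex.normSq_eq_norm_sq, ← Complex.normSq_eq_norm_sq]
  have key := mul_nonneg (sub_nonneg.mpr hz2) (sub_nonneg.mpr ha2)
  simp only [Complex.normSq_apply, Complex.sub_re, Complex.sub_im, Complex.mul_re,
    Complex.mul_im, Complex.conj_re, Complex.conj_im, Complex.one_re, Complex.one_im] at key ⊢
  nlinarith [key]

lemma Mob.differentiableAt_toFun (φ : Mob) {z : ℂ} (hz : 1 - conj φ.center * z ≠ 0) :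
    DifferentiableAt ℂ φ.toFun z := by
  unfold Mob.toFun
  fun_prop (disch := assumption)

/-- The action `(z₁, z₂) ↦ (φ₁ z₁, φ₂ z₂)` of an element `φ = (φ₁, φ₂)` of Möb × Möb. -/
def mobMap (φ : Mob × Mob) (z : ℂ × ℂ) : ℂ × ℂ := (φ.1.toFun z.1, φ.2.toFun z.2)

lemma differentiableAt_mobMap (φ : Mob × Mob) {z : ℂ × ℂ}
    (h₁ : 1 - conj φ.1.center * z.1 ≠ 0) (h₂ : 1 - conj φ.2.center * z.2 ≠ 0) :
    DifferentiableAt ℂ (mobMap φ) z :=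
  ((φ.1.differentiableAt_toFun h₁).comp z differentiableAt_fst).prodMk
    ((φ.2.differentiableAt_toFun h₂).comp z differentiableAt_snd)

lemma mobMap_mem (φ : Mob × Mob) {z : ℂ × ℂ} (hz : z ∈ closedBidisc) :
    mobMap φ z ∈ closedBidisc := by
  simp only [Set.mem_prod, mem_closedBall_zero_iff] at hz ⊢
  exact ⟨φ.1.norm_toFun_le hz.1, φ.2.norm_toFun_le hz.2⟩

/-- The map `mobMap φ` as a continuous self-map of the closed bidisc. -/
def mobC (φ : Mob × Mob) : C(closedBidisc, closedBidisc) where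
  toFun z := ⟨mobMap φ z, mobMap_mem φ z.2⟩
  continuous_toFun := by
    refine Continuous.subtype_mk ?_ _
    refine continuous_iff_continuousAt.mpr fun z => ?_
    have hz := z.2
    simp only [Set.mem_prod, mem_closedBall_zero_iff] at hz
    exact ContinuousAt.comp (f := fun w : closedBidisc => (w : ℂ × ℂ)) (x := z)
      (differentiableAt_mobMap φ (φ.1.denom_ne_zero hz.1)
        (φ.2.denom_ne_zero hz.2)).continuousAt continuous_subtype_val.continuousAt

lemma comp_mobC_mem_holomorphicNhd (φ : Mob × Mob) {f : C(closedBidisc, ℂ)}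
    (hf : f ∈ holomorphicNhd) : f.comp (mobC φ) ∈ holomorphicNhd := by
  obtain ⟨U, hU, hKU, F, hF, hfF⟩ := hf
  let W : Set (ℂ × ℂ) :=
    {z | 1 - conj φ.1.center * z.1 ≠ 0} ∩ {z | 1 - conj φ.2.center * z.2 ≠ 0}
  have hW : IsOpen W :=
    (isOpen_ne_fun (by fun_prop) (by fun_prop)).inter (isOpen_ne_fun (by fun_prop) (by fun_prop))
  have hd : DifferentiableOn ℂ (mobMap φ) W := fun z hz =>
    (differentiableAt_mobMap φ hz.1 hz.2).differentiableWithinAt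
  refine ⟨W ∩ mobMap φ ⁻¹' U, hd.continuousOn.isOpen_inter_preimage hW hU, fun z hz => ?_,
    F ∘ mobMap φ, hF.comp (hd.mono Set.inter_subset_left) fun z hz => hz.2, fun z => ?_⟩
  · refine ⟨?_, hKU (mobMap_mem φ hz)⟩
    simp only [Set.mem_prod, mem_closedBall_zero_iff] at hz
    exact ⟨φ.1.denom_ne_zero hz.1, φ.2.denom_ne_zero hz.2⟩
  · exact hfF (mobC φ z)

lemma comp_mobC_mem_algebra (φ : Mob × Mob) {f : C(closedBidisc, ℂ)}
    (hf : f ∈ algebra) : f.comp (mobC φ) ∈ algebra :=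
  map_mem_closure (f := fun g : C(closedBidisc, ℂ) => g.comp (mobC φ))
    (ContinuousMap.compRightAlgHom_continuous ℂ ℂ (mobC φ)) hf
    fun _ hg => comp_mobC_mem_holomorphicNhd φ hg

/-- The algebra homomorphism `f ↦ f ∘ φ` of the bidisc algebra. -/
def compMob (φ : Mob × Mob) : algebra →ₐ[ℂ] algebra :=
  ((ContinuousMap.compRightAlgHom ℂ ℂ (mobC φ)).comp algebra.val).codRestrict algebra
    fun f => comp_mobC_mem_algebra φ f.2

lemma compMob_apply (φ : Mob × Mob) (f : algebra) (z : closedBidisc) :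
    (compMob φ f : C(closedBidisc, ℂ)) z = (f : C(closedBidisc, ℂ)) (mobC φ z) := rfl

lemma norm_compMob_le (φ : Mob × Mob) (f : algebra) : ‖compMob φ f‖ ≤ ‖f‖ :=
  (ContinuousMap.norm_le _ (norm_nonneg _)).mpr fun z =>
    ContinuousMap.norm_coe_le_norm (f : C(closedBidisc, ℂ)) (mobC φ z)

/-! ### Hilbert modules over the bidisc algebra -/

/-- A Hilbert module over the bidisc algebra with underlying Hilbert space `H`: a (unital)
module action `(f, h) ↦ f · h` with `‖f · h‖ ≤ C ‖f‖ ‖h‖`. -/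
structure HilbertModule (H : Type*) [NormedAddCommGroup H] [InnerProductSpace ℂ H] where
  /-- the operator `h ↦ f · h` -/
  act : algebra →ₐ[ℂ] (H →L[ℂ] H)
  bounded : ∃ C : ℝ, 0 < C ∧ ∀ (f : algebra) (h : H), ‖act f h‖ ≤ C * ‖f‖ * ‖h‖

/-- Given a pair `T = (T₁, T₂)` of operators and `w ∈ ℂ²`, the operator
`D_{T - w} h = ((T₁ - w₁) h, (T₂ - w₂) h)`. -/
def dOp {H : Type*} [NormedAddCommGroup H] [InnerProductSpace ℂ H]
    (T : (H →L[ℂ] H) × (H →L[ℂ] H)) (w : ℂ × ℂ) : H →L[ℂ] H × H :=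
  (T.1 - w.1 • ContinuousLinearMap.id ℂ H).prod (T.2 - w.2 • ContinuousLinearMap.id ℂ H)

/-- The Cowen-Douglas class `B₁(Ω)` of pairs of commuting operators. -/
structure CowenDouglas {H : Type*} [NormedAddCommGroup H] [InnerProductSpace ℂ H]
    (T : (H →L[ℂ] H) × (H →L[ℂ] H)) (Ω : Set (ℂ × ℂ)) : Prop where
  commute : Commute T.1 T.2
  isClosed_range : ∀ w ∈ Ω, IsClosed (Set.range (dOp T w))
  dense_span : Dense ((⨆ w ∈ Ω, LinearMap.ker (dOp T w).toLinearMap : Submodule ℂ H) : Set H)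
  finrank_ker : ∀ w ∈ Ω, Module.finrank ℂ (LinearMap.ker (dOp T w).toLinearMap) = 1

namespace HilbertModule

variable {H : Type*} [NormedAddCommGroup H] [InnerProductSpace ℂ H]

/-- The module `φ_* M`: the same Hilbert space with the action `(f, h) ↦ (f ∘ φ) · h`. -/
def pushforward (M : HilbertModule H) (φ : Mob × Mob) : HilbertModule H where
  act := M.act.comp (compMob φ)
  bounded := by
    obtain ⟨C, hC, h⟩ := M.bounded
    refine ⟨C, hC, fun f x => (h _ x).trans ?_⟩
    exact mul_le_mul_of_nonneg_right
      (mul_le_mul_of_nonneg_left (norm_compMob_le φ f) hC.le) (norm_nonneg x)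

/-- Two Hilbert modules are isomorphic if there is a unitary module map between them. -/
def Isomorphic {H' : Type*} [NormedAddCommGroup H'] [InnerProductSpace ℂ H']
    (M : HilbertModule H) (N : HilbertModule H') : Prop :=
  ∃ U : H ≃ₗᵢ[ℂ] H', ∀ (f : algebra) (h : H), U (M.act f h) = N.act f (U h)

/-- A Hilbert module `M` is Möb × Möb - homogeneous if `φ_* M` is isomorphic to `M` for every
`φ` in Möb × Möb. -/
def IsHomogeneous (M : HilbertModule H) : Prop :=
  ∀ φ : Mob × Mob, (M.pushforward φ).Isomorphic M

/-- A Hilbert module is in `B₁(𝔻²)` if the pair of adjoints of the operators of multiplication by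
the coordinate functions is in the Cowen-Douglas class `B₁(𝔻²)` (the bidisc is invariant under
complex conjugation). -/
def InB₁ [CompleteSpace H] (M : HilbertModule H) : Prop :=
  CowenDouglas (ContinuousLinearMap.adjoint (M.act coord₁),
    ContinuousLinearMap.adjoint (M.act coord₂)) openBidisc

end HilbertModule

/-! ### The spaces `M^{(l,m)}` -/

/-- The function `(1 - z w̄)^{-l}`. -/
def discKernel (l : ℝ≥0) (z w : ℂ) : ℂ := (1 - z * conj w) ^ (-((l : ℝ) : ℂ))

/-- The kernel `K^{(l,m)}(z, w) = (1 - z₁ w̄₁)^{-l} (1 - z₂ w̄₂)^{-m}` on the bidisc; the number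
`K^{(l,m)}(z, w)` is regarded as an operator on `ℂ`. -/
def kernel (l m : ℝ≥0) : Matrix openBidisc openBidisc (ℂ →L[ℂ] ℂ) := fun z w =>
  (discKernel l (z : ℂ × ℂ).1 (w : ℂ × ℂ).1 * discKernel m (z : ℂ × ℂ).2 (w : ℂ × ℂ).2) •
    ContinuousLinearMap.id ℂ ℂ

lemma choose_nonneg (l : ℝ≥0) (n : ℕ) : 0 ≤ Ring.choose ((l : ℝ) + n - 1) n := by
  have hp : 0 ≤ (ascPochhammer ℝ n).eval (l : ℝ) := by
    induction n with
    | zero => simp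
    | succ n ih => rw [ascPochhammer_succ_eval]; positivity
  have h := Ring.factorial_nsmul_multichoose_eq_ascPochhammer (l : ℝ) n
  rw [Polynomial.ascPochhammer_smeval_eq_eval, nsmul_eq_mul] at h
  rw [← Ring.multichoose_eq]
  exact (mul_nonneg_iff_of_pos_left (by positivity)).mp (h ▸ hp)

lemma hasSum_discKernel (l : ℝ≥0) {z w : ℂ} (hz : ‖z‖ < 1) (hw : ‖w‖ < 1) :
    HasSum (fun n : ℕ => ((Ring.choose ((l : ℝ) + n - 1) n : ℝ) : ℂ) * (z ^ n * conj (w ^ n)))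
      (discKernel l z w) := by
  have hzw : ‖z * conj w‖ < 1 := by
    rw [norm_mul, RCLike.norm_conj]
    nlinarith [norm_nonneg z, norm_nonneg w]
  have h := (Complex.one_div_one_sub_cpow_hasFPowerSeriesOnBall_zero ((l : ℝ) : ℂ)).hasSum
    (y := z * conj w) (by
      rw [← ENNReal.ofReal_one, Metric.eball_ofReal]; simpa using hzw)
  simp only [zero_add, one_div, ← Complex.cpow_neg] at h
  refine (congrArg (fun g : ℕ → ℂ => HasSum g (discKernel l z w)) (funext fun n => ?_)).mp h
  rw [FormalMultilinearSeries.ofScalars_apply_eq, smul_eq_mul, mul_pow, map_pow,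
    Complex.ofReal_choose]
  push_cast
  rfl

lemma conj_discKernel (l : ℝ≥0) {z w : ℂ} (hz : ‖z‖ < 1) (hw : ‖w‖ < 1) :
    conj (discKernel l z w) = discKernel l w z := by
  refine ((hasSum_discKernel l hz hw).map (starRingEnd ℂ) Complex.continuous_conj).unique ?_
  convert hasSum_discKernel l hw hz using 2 with n
  simp [mul_comm]

/-- Positivity of the sums `Σ_{x,y} k(x,y) c_y c̄_x` is preserved when `k` is multiplied by the
kernel `(1 - p(x) p̄(y))^{-l}`. -/
lemma sum_discKernel_nonneg (l : ℝ≥0) {X : Type*} (s : Finset X) (p : X → ℂ)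
    (hp : ∀ x, ‖p x‖ < 1) (k : X → X → ℂ)
    (hk : ∀ c : X → ℂ, 0 ≤ (∑ x ∈ s, ∑ y ∈ s, k x y * (c y * conj (c x))).re) (c : X → ℂ) :
    0 ≤ (∑ x ∈ s, ∑ y ∈ s, discKernel l (p x) (p y) * k x y * (c y * conj (c x))).re := by
  have h : HasSum (fun n : ℕ => ∑ x ∈ s, ∑ y ∈ s,
      ((Ring.choose ((l : ℝ) + n - 1) n : ℝ) : ℂ) * (p x ^ n * conj (p y ^ n)) * k x y *
        (c y * conj (c x)))
      (∑ x ∈ s, ∑ y ∈ s, discKernel l (p x) (p y) * k x y * (c y * conj (c x))) :=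
    hasSum_sum fun x _ => hasSum_sum fun y _ =>
      ((hasSum_discKernel l (hp x) (hp y)).mul_right _).mul_right _
  refine (Complex.hasSum_re h).nonneg fun n => ?_
  have h2 := mul_nonneg (choose_nonneg l n) (hk fun x => conj (p x ^ n) * c x)
  rw [← Complex.re_ofReal_mul, Finset.mul_sum] at h2
  refine h2.trans_eq (congrArg Complex.re (Finset.sum_congr rfl fun x _ => ?_))
  rw [Finset.mul_sum]
  refine Finset.sum_congr rfl fun y _ => ?_
  simp only [map_mul, Complex.conj_conj]
  ring

lemma posSemidef_kernel (l m : ℝ≥0) : (kernel l m).PosSemidef := by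
  have hn : ∀ z : openBidisc, ‖(z : ℂ × ℂ).1‖ < 1 ∧ ‖(z : ℂ × ℂ).2‖ < 1 := fun z => by
    simpa only [Set.mem_prod, mem_ball_zero_iff] using z.2
  have htfae := (RKHS.posSemidef_tfae (K := kernel l m)).out 0 2
  refine htfae.mpr ⟨?_, fun v => ?_⟩
  · ext z w
    simp [kernel, Matrix.conjTranspose_apply, ContinuousLinearMap.star_eq_adjoint,
      conj_discKernel, hn, show ContinuousLinearMap.adjoint (ContinuousLinearMap.id ℂ ℂ) =
        ContinuousLinearMap.id ℂ ℂ from star_one (ℂ →L[ℂ] ℂ)]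
  · have h := sum_discKernel_nonneg l v.support (fun z : openBidisc => (z : ℂ × ℂ).1)
      (fun z => (hn z).1) (fun z w => discKernel m (z : ℂ × ℂ).2 (w : ℂ × ℂ).2 * 1)
      (sum_discKernel_nonneg m v.support (fun z : openBidisc => (z : ℂ × ℂ).2)
        (fun z => (hn z).2) (fun _ _ => 1) fun c => ?_) fun z => v z
    · rw [← Complex.conj_re, map_sum] at h
      simp only [Finsupp.sum]
      rw [Finset.sum_comm]
      refine h.trans_eq (congrArg Complex.re (Finset.sum_congr rfl fun x _ => ?_))
      rw [map_sum]
      refine Finset.sum_congr rfl fun y _ => ?_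
      simp [kernel]
      ring
    · simp only [one_mul]
      rw [← Finset.sum_comm]
      simp only [← Finset.mul_sum, ← Finset.sum_mul, ← map_sum, Complex.mul_conj]
      exact Complex.normSq_nonneg _

instance (l m : ℝ≥0) : Fact (kernel l m).PosSemidef := ⟨posSemidef_kernel l m⟩

/-- The Hilbert space `M^{(l,m)}` of functions on the bidisc with reproducing kernel
`K^{(l,m)}`. -/
abbrev modelSpace (l m : ℝ≥0) : Type := RKHS.OfKernel (kernel l m)

/-- The Hilbert module `M` is isomorphic to `M^{(l,m)}`, on which the bidisc algebra acts by
pointwise multiplication: there is a unitary `U` from `M` onto `M^{(l,m)}` with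
`(U (f · h)) (z) = f (z) (U h) (z)`. -/
def HilbertModule.IsomorphicToModel {H : Type*} [NormedAddCommGroup H] [InnerProductSpace ℂ H]
    (M : HilbertModule H) (l m : ℝ≥0) : Prop :=
  ∃ U : H ≃ₗᵢ[ℂ] modelSpace l m, ∀ (f : algebra) (h : H) (z : openBidisc),
    U (M.act f h) z = (f : C(closedBidisc, ℂ)) (incl z) * U h z

end Bidisc

end

open scoped ComplexConjugate NNReal

noncomputable section

namespace Bidisc

/-! ### Polynomials are dense in the bidisc algebra -/

section Density

variable {X : Type*} [TopologicalSpace X] [CompactSpace X]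

/-! The module is determined by the Gram kernel of a holomorphic frame of joint eigenvectors of the
adjoints, and homogeneity leaves only the kernels of the model spaces.

Closed range and one-dimensional kernels give, near the origin, a holomorphic frame `γ` of joint
eigenvectors, normalized by `⟨γ 0, γ w⟩ = 1` (`CowenDouglas.exists_frame`). A unitary from `φ_* M`
to `M` permutes the eigenlines, so it sends `γ w` to a multiple of `γ (σ w)`, where `σ` is `φ`
conjugated by complex conjugation. The multipliers need no regularity: comparing inner products at
`0`, `a` and `w` and using the normalization eliminates them (`exists_frame_inner_eq`). Rotations
then make the kernel invariant under the torus, so that `⟨γ z, γ w⟩ = F (z̄₁ w₁) (z̄₂ w₂)`. The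
automorphism that sends `a` to `0` yields a functional equation, which splits `F` into a product
and, differentiated in one variable, becomes `f' (t) (1 - t) = f' (0) f (t)`. Its solutions are the
powers `(1 - t)^{-l}`, and strict positivity of `‖γ w - γ 0‖²` for `w ≠ 0` forces `l > 0`
(`exists_inner_eq_discKernel`).

Equality of Gram kernels near the origin gives the unitary
(`exists_linearIsometryEquiv_of_inner_eq`), since by analytic continuation the vectors over a
neighbourhood of the origin are total on both sides. To pass from coordinates to all of the bidisc
algebra, closed subalgebras containing both coordinates are shown to be everything
(`eq_top_of_coord_mem`). -/

lemma exists_mem_eq_inv_sub (A : Subalgebra ℂ C(X, ℂ)) (hA : IsClosed (A : Set C(X, ℂ)))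
    {p : C(X, ℂ)} (hp : p ∈ A) (hp1 : ∀ x, ‖p x‖ ≤ 1) {ζ : ℂ} (hζ : 1 < ‖ζ‖) :
    ∃ u ∈ A, ∀ x, u x = (ζ - p x)⁻¹ := by
  have : CompleteSpace A := hA.completeSpace_coe
  have hζ0 : ζ ≠ 0 := norm_pos_iff.mp (by linarith)
  -- Neumann series in the Banach algebra `A`: `(ζ - p)⁻¹ = ζ⁻¹ ∑ (p / ζ)ⁿ`, with `‖p / ζ‖ < 1`.
  let q : A := ζ⁻¹ • ⟨p, hp⟩
  have hq : ‖q‖ < 1 := by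
    have h1 : ‖(⟨p, hp⟩ : A)‖ ≤ 1 := (ContinuousMap.norm_le _ zero_le_one).mpr hp1
    calc ‖q‖ ≤ ‖ζ⁻¹‖ * ‖(⟨p, hp⟩ : A)‖ := norm_smul_le _ _
      _ ≤ ‖ζ⁻¹‖ * 1 := by gcongr
      _ < 1 := by rw [mul_one, norm_inv]; exact inv_lt_one_of_one_lt₀ hζ
  have h := geom_series_mul_neg q hq
  refine ⟨ζ⁻¹ • (∑' n, q ^ n : A), A.smul_mem (Subtype.prop _) _, fun x => ?_⟩
  have hx := congrArg (fun a : A => (a : C(X, ℂ)) x) h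
  simp only [Subalgebra.coe_mul, Subalgebra.coe_sub, Subalgebra.coe_one, ContinuousMap.mul_apply,
    ContinuousMap.sub_apply, ContinuousMap.one_apply] at hx
  have hqx : (q : C(X, ℂ)) x = ζ⁻¹ * p x := rfl
  rw [hqx] at hx
  rw [ContinuousMap.smul_apply, smul_eq_mul]
  refine eq_inv_of_mul_eq_one_left ?_
  rw [← hx]
  field_simp

/-- The Cauchy integrand is a continuous curve in the Banach space `A`, so its integral is an
element of `A`; evaluation at each point commutes with the integral and identifies it with `2πi g`.
-/
lemma mem_of_cauchy_integral (A : Subalgebra ℂ C(X, ℂ)) (hA : IsClosed (A : Set C(X, ℂ)))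
    {p : C(X, ℂ)} (hp : p ∈ A) (hp1 : ∀ x, ‖p x‖ ≤ 1) {R : ℝ} (hR : 1 < R)
    (G : C(ℝ × X, ℂ)) (hG : ∀ θ, G.curry θ ∈ A) {g : C(X, ℂ)}
    (hg : ∀ x, (∫ θ in (0 : ℝ)..2 * Real.pi, deriv (circleMap 0 R) θ *
      ((circleMap 0 R θ - p x)⁻¹ * G (θ, x))) = 2 * Real.pi * Complex.I * g x) : g ∈ A := by
  have : CompleteSpace A := hA.completeSpace_coe
  have hn : ∀ θ, ‖circleMap 0 R θ‖ = R := fun θ => by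
    rw [norm_circleMap_zero, abs_of_pos (by linarith)]
  have hne : ∀ y : ℝ × X, circleMap 0 R y.1 - p y.2 ≠ 0 := fun y h => by
    have h1 := congrArg norm (sub_eq_zero.mp h)
    rw [hn] at h1
    linarith [hp1 y.2]
  let I : C(ℝ × X, ℂ) := ⟨fun y => deriv (circleMap 0 R) y.1 *
    ((circleMap 0 R y.1 - p y.2)⁻¹ * G y), by
      refine Continuous.mul ?_ (Continuous.mul (Continuous.inv₀ ?_ hne) G.continuous)
      · simp only [deriv_circleMap]; fun_prop
      · fun_prop⟩
  have hI : ∀ θ, I.curry θ ∈ A := fun θ => by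
    obtain ⟨u, hu, hux⟩ := exists_mem_eq_inv_sub A hA hp hp1
      (ζ := circleMap 0 R θ) (by rw [hn]; exact hR)
    convert A.smul_mem (A.mul_mem hu (hG θ)) (deriv (circleMap 0 R) θ) using 1
    ext x
    simp [I, hux]
  let J : ℝ → A := fun θ => ⟨I.curry θ, hI θ⟩
  have hJ : Continuous J := I.curry.continuous.subtype_mk _
  have key : g = (2 * Real.pi * Complex.I)⁻¹ •
      ((∫ θ in (0 : ℝ)..2 * Real.pi, J θ : A) : C(X, ℂ)) := by
    ext x
    let L : A →L[ℂ] ℂ := (ContinuousMap.evalCLM ℂ x).comp A.toSubmodule.subtypeL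
    have h1 := L.intervalIntegral_comp_comm
      (hJ.intervalIntegrable (μ := MeasureTheory.volume) 0 (2 * Real.pi))
    have h2 : L (∫ θ in (0 : ℝ)..2 * Real.pi, J θ) = 2 * Real.pi * Complex.I * g x :=
      h1.symm.trans (hg x)
    rw [ContinuousMap.smul_apply, smul_eq_mul]
    change g x = _ * L (∫ θ in (0 : ℝ)..2 * Real.pi, J θ)
    rw [h2, inv_mul_cancel_left₀ Complex.two_pi_I_ne_zero]
  rw [key]
  exact A.smul_mem (Subtype.prop _) _

end Density

lemma cauchy_integral_eq {R : ℝ} {f : ℂ → ℂ} {w : ℂ}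
    (hf : DifferentiableOn ℂ f (Metric.closedBall 0 R)) (hw : w ∈ Metric.ball (0 : ℂ) R) :
    (∫ θ in (0 : ℝ)..2 * Real.pi, deriv (circleMap 0 R) θ *
      ((circleMap 0 R θ - w)⁻¹ * f (circleMap 0 R θ))) = 2 * Real.pi * Complex.I * f w := by
  have := hf.circleIntegral_sub_inv_smul hw
  simpa only [circleIntegral, smul_eq_mul] using this

/-- Cauchy's formula is applied once in each variable, on circles of radius slightly larger than 1:
the formula in `z₂` puts the functions `F (ζ, z₂)` with `ζ` fixed into `A`, and the formula in `z₁`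
then reaches `F`. -/
lemma holomorphicNhd_le {A : Subalgebra ℂ C(closedBidisc, ℂ)}
    (hA : IsClosed (A : Set C(closedBidisc, ℂ))) (h₁ : (coord₁ : C(closedBidisc, ℂ)) ∈ A)
    (h₂ : (coord₂ : C(closedBidisc, ℂ)) ∈ A) : holomorphicNhd ≤ A := by
  rintro f ⟨U, hU, hKU, F, hF, hfF⟩
  have hK : IsCompact closedBidisc :=
    (isCompact_closedBall (0 : ℂ) 1).prod (isCompact_closedBall (0 : ℂ) 1)
  obtain ⟨δ, hδ, hδU⟩ := hK.exists_cthickening_subset_open hU hKU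
  -- The norm of `ℂ × ℂ` is the maximum norm, so bidiscs are balls and a thickening is a larger
  -- bidisc.
  have hcb : closedBidisc = Metric.closedBall (0 : ℂ × ℂ) 1 := closedBall_prod_same 0 0 1
  rw [hcb, cthickening_closedBall hδ.le zero_le_one] at hδU
  set R : ℝ := 1 + δ with hRdef
  have hR : 1 < R := by linarith
  have hRU : ∀ z₁ z₂ : ℂ, ‖z₁‖ ≤ R → ‖z₂‖ ≤ R → (z₁, z₂) ∈ U := fun z₁ z₂ a b =>
    hδU (by
      rw [mem_closedBall_zero_iff, Prod.norm_mk]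
      exact max_le (by linarith) (by linarith))
  have hcm : ∀ θ, ‖circleMap 0 R θ‖ ≤ R := fun θ => by
    rw [norm_circleMap_zero, abs_of_pos (by linarith)]
  have hx : ∀ x : closedBidisc, ‖(x : ℂ × ℂ).1‖ ≤ 1 ∧ ‖(x : ℂ × ℂ).2‖ ≤ 1 := fun x => by
    simpa only [Set.mem_prod, mem_closedBall_zero_iff] using x.2
  have hFc : ContinuousOn F U := hF.continuousOn
  let G₁ : C(ℝ × closedBidisc, ℂ) := ⟨fun y => F (circleMap 0 R y.1, (y.2 : ℂ × ℂ).2),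
    hFc.comp_continuous (by fun_prop)
      fun y => hRU _ _ (hcm _) ((hx y.2).2.trans hR.le)⟩
  refine mem_of_cauchy_integral A hA h₁ (fun x => (hx x).1) hR G₁ (fun θ => ?_) fun x => ?_
  · let G₂ : C(ℝ × closedBidisc, ℂ) := ⟨fun y => F (circleMap 0 R θ, circleMap 0 R y.1),
      hFc.comp_continuous (by fun_prop) fun y => hRU _ _ (hcm _) (hcm _)⟩
    refine mem_of_cauchy_integral A hA h₂ (fun x => (hx x).2) hR G₂ (fun φ => ?_) fun x => ?_
    · exact A.algebraMap_mem (F (circleMap 0 R θ, circleMap 0 R φ))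
    · refine cauchy_integral_eq (f := fun ζ => F (circleMap 0 R θ, ζ)) ?_ ?_
      · refine hF.comp (by fun_prop) fun ζ hζ => hRU _ _ (hcm _) (mem_closedBall_zero_iff.mp hζ)
      · exact mem_ball_zero_iff.mpr ((hx x).2.trans_lt hR)
  · rw [hfF]
    refine cauchy_integral_eq (f := fun ζ => F (ζ, (x : ℂ × ℂ).2)) ?_ ?_
    · refine hF.comp (by fun_prop) fun ζ hζ =>
        hRU _ _ (mem_closedBall_zero_iff.mp hζ) ((hx x).2.trans hR.le)
    · exact mem_ball_zero_iff.mpr ((hx x).1.trans_lt hR)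

/-- A closed subalgebra of the bidisc algebra that contains the coordinate functions is the
whole bidisc algebra. -/
lemma eq_top_of_coord_mem {A : Subalgebra ℂ algebra} (hA : IsClosed (A : Set algebra))
    (h₁ : coord₁ ∈ A) (h₂ : coord₂ ∈ A) : A = ⊤ := by
  have hcl : IsClosed (algebra : Set C(closedBidisc, ℂ)) :=
    holomorphicNhd.isClosed_topologicalClosure
  have hB : IsClosed ((A.map algebra.val : Subalgebra ℂ _) : Set C(closedBidisc, ℂ)) := by
    rw [Subalgebra.coe_map]
    exact hcl.isClosedEmbedding_subtypeVal.isClosedMap _ hA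
  have h := (holomorphicNhd_le hB ⟨_, h₁, rfl⟩ ⟨_, h₂, rfl⟩)
  have h' : algebra ≤ A.map algebra.val := Subalgebra.topologicalClosure_minimal h hB
  refine eq_top_iff.mpr fun f _ => ?_
  obtain ⟨g, hg, hgf⟩ := h' f.2
  rwa [← Subtype.ext (show (g : C(closedBidisc, ℂ)) = f from hgf)]

/-! ### Local holomorphic frames -/

section Frame

open ContinuousLinearMap

variable {H : Type*} [NormedAddCommGroup H] [InnerProductSpace ℂ H]

lemma mem_ker_dOp {T : (H →L[ℂ] H) × (H →L[ℂ] H)} {w : ℂ × ℂ} {x : H} :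
    x ∈ LinearMap.ker (dOp T w).toLinearMap ↔ T.1 x = w.1 • x ∧ T.2 x = w.2 • x := by
  simp [dOp, sub_eq_zero]

/-- The open mapping theorem onto the range supplies some preimage of `D x` of controlled norm. A
vector orthogonal to the kernel is the shortest preimage, by Pythagoras, so it obeys the same bound.
-/
lemma exists_bound_of_isClosed_range [CompleteSpace H] {E : Type*} [NormedAddCommGroup E]
    [NormedSpace ℂ E] [CompleteSpace E] (D : H →L[ℂ] E) (hD : IsClosed (Set.range D)) :
    ∃ C > 0, ∀ x : H, (∀ y ∈ LinearMap.ker D.toLinearMap, inner ℂ y x = 0) → ‖x‖ ≤ C * ‖D x‖ := by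
  have hc : IsClosed ((LinearMap.range D.toLinearMap : Submodule ℂ E) : Set E) := by
    simpa [LinearMap.coe_range] using hD
  have : CompleteSpace (LinearMap.range D.toLinearMap) := hc.completeSpace_coe
  obtain ⟨C, hC, h⟩ := ContinuousLinearMap.exists_preimage_norm_le D.rangeRestrict
    (LinearMap.surjective_rangeRestrict _)
  refine ⟨C, hC, fun x hx => ?_⟩
  obtain ⟨x', hx', hle⟩ := h (D.rangeRestrict x)
  have hDx : D x' = D x := congrArg Subtype.val hx'
  refine le_trans ?_ hle
  have hk : inner ℂ (x' - x) x = 0 := hx _ (by simp [hDx])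
  have h1 := norm_add_sq_eq_norm_sq_add_norm_sq_of_inner_eq_zero (𝕜 := ℂ) (x' - x) x hk
  rw [sub_add_cancel] at h1
  nlinarith [norm_nonneg x, norm_nonneg x', mul_self_nonneg ‖x' - x‖]

/-- With `S = T - w₀` and `v` a unit vector of the kernel at `w₀`, the operator `A = S₁* S₁ + S₂* S₂
+ v ⊗ v*` is invertible, hence so is `B w = A - ∑ (wᵢ - w₀ᵢ) Sᵢ*` for `w` near `w₀`. A joint
eigenvector `x` at `w` satisfies `B w x = ⟨v, x⟩ v`, so it is a multiple of `γ w = (B w)⁻¹ v`, which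
is analytic in `w`. -/
theorem CowenDouglas.exists_frame [CompleteSpace H] {T : (H →L[ℂ] H) × (H →L[ℂ] H)}
    {Ω : Set (ℂ × ℂ)} (hΩ : IsOpen Ω) (hT : CowenDouglas T Ω) {w₀ : ℂ × ℂ} (hw₀ : w₀ ∈ Ω) :
    ∃ δ > 0, ∃ γ : ℂ × ℂ → H, AnalyticOnNhd ℂ γ (Metric.ball w₀ δ) ∧ Metric.ball w₀ δ ⊆ Ω ∧
      ∀ w ∈ Metric.ball w₀ δ, LinearMap.ker (dOp T w).toLinearMap = Submodule.span ℂ {γ w} ∧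
        inner ℂ (γ w₀) (γ w) = 1 := by
  obtain ⟨v, hv, hvk⟩ : ∃ v : H, ‖v‖ = 1 ∧
      LinearMap.ker (dOp T w₀).toLinearMap = Submodule.span ℂ {v} := by
    obtain ⟨⟨u, hu⟩, hu0, hspan⟩ := finrank_eq_one_iff'.mp (hT.finrank_ker w₀ hw₀)
    have hu0' : u ≠ 0 := fun h => hu0 (Subtype.ext h)
    have hn : (‖u‖ : ℂ)⁻¹ ≠ 0 := inv_ne_zero (by simpa using hu0')
    refine ⟨(‖u‖ : ℂ)⁻¹ • u, norm_smul_inv_norm hu0', le_antisymm (fun x hx => ?_) ?_⟩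
    · rw [Submodule.span_singleton_smul_eq (IsUnit.mk0 _ hn)]
      obtain ⟨c, hc⟩ := hspan ⟨x, hx⟩
      exact Submodule.mem_span_singleton.mpr ⟨c, congrArg Subtype.val hc⟩
    · rw [Submodule.span_singleton_le_iff_mem]
      exact Submodule.smul_mem _ _ hu
  have hvv : inner ℂ v v = 1 := by rw [inner_self_eq_norm_sq_to_K, hv]; simp
  set S₁ : H →L[ℂ] H := T.1 - w₀.1 • ContinuousLinearMap.id ℂ H with hS₁
  set S₂ : H →L[ℂ] H := T.2 - w₀.2 • ContinuousLinearMap.id ℂ H with hS₂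
  have hSv : S₁ v = 0 ∧ S₂ v = 0 := by
    have : v ∈ LinearMap.ker (dOp T w₀).toLinearMap :=
      hvk ▸ Submodule.mem_span_singleton_self v
    rw [mem_ker_dOp] at this
    simp [hS₁, hS₂, this]
  have hDS : ∀ x, dOp T w₀ x = (S₁ x, S₂ x) := fun x => rfl
  obtain ⟨C, hC, hbound⟩ := exists_bound_of_isClosed_range _ (hT.isClosed_range w₀ hw₀)
  set A : H →L[ℂ] H := adjoint S₁ ∘L S₁ + adjoint S₂ ∘L S₂ + (innerSL ℂ v).smulRight v with hA
  have hAx : ∀ x, A x = adjoint S₁ (S₁ x) + adjoint S₂ (S₂ x) + inner ℂ v x • v := fun x => by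
    simp [hA]
  have hAinner : ∀ x, inner ℂ (A x) x =
      ((‖S₁ x‖ ^ 2 + ‖S₂ x‖ ^ 2 + ‖inner ℂ v x‖ ^ 2 : ℝ) : ℂ) := fun x => by
    rw [hAx, inner_add_left, inner_add_left, adjoint_inner_left, adjoint_inner_left,
      inner_smul_left, inner_self_eq_norm_sq_to_K, inner_self_eq_norm_sq_to_K, RCLike.conj_mul]
    simp
  -- `A` is bounded below: on the complement of `v` this is the closed range estimate with constant
  -- `C`, and the rank one term takes care of the direction `v`.
  have hAunit : IsUnit A := by
    refine isUnit_of_forall_le_norm_inner_map A (c := ⟨(C ^ 2 + 1)⁻¹, by positivity⟩)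
      (show (0 : ℝ) < (C ^ 2 + 1)⁻¹ by positivity) fun x => ?_
    rw [hAinner, Complex.norm_real, Real.norm_of_nonneg (by positivity)]
    change _ * (C ^ 2 + 1)⁻¹ ≤ _
    rw [mul_inv_le_iff₀ (by positivity)]
    set c := inner ℂ v x with hc
    set y := x - c • v with hy
    have hvy : inner ℂ v y = 0 := by
      rw [hy, inner_sub_right, inner_smul_right, hvv, mul_one, sub_self]
    have hx : x = y + c • v := by rw [hy, sub_add_cancel]
    have hSx : S₁ x = S₁ y ∧ S₂ x = S₂ y := by simp [hx, hSv]
    have hyb := hbound y fun z hz => by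
      rw [hvk] at hz
      obtain ⟨a, rfl⟩ := Submodule.mem_span_singleton.mp hz
      rw [inner_smul_left, hvy, mul_zero]
    have hnx : ‖x‖ * ‖x‖ = ‖y‖ * ‖y‖ + ‖c‖ * ‖c‖ := by
      have h := norm_add_sq_eq_norm_sq_add_norm_sq_of_inner_eq_zero (𝕜 := ℂ) y (c • v) (by
        rw [inner_smul_right, ← inner_conj_symm, hvy]; simp)
      rw [← hx] at h
      rw [h, norm_smul, hv, mul_one]
    rw [hSx.1, hSx.2]
    have hD : ‖dOp T w₀ y‖ ^ 2 ≤ ‖S₁ y‖ ^ 2 + ‖S₂ y‖ ^ 2 := by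
      rw [hDS, Prod.norm_mk]
      rcases max_choice ‖S₁ y‖ ‖S₂ y‖ with h | h <;> rw [h] <;>
        nlinarith [sq_nonneg ‖S₁ y‖, sq_nonneg ‖S₂ y‖]
    have hy2 : ‖y‖ ^ 2 ≤ C ^ 2 * (‖S₁ y‖ ^ 2 + ‖S₂ y‖ ^ 2) :=
      calc ‖y‖ ^ 2 ≤ (C * ‖dOp T w₀ y‖) ^ 2 := by gcongr
        _ = C ^ 2 * ‖dOp T w₀ y‖ ^ 2 := by ring
        _ ≤ _ := by gcongr
    nlinarith [sq_nonneg ‖S₁ y‖, sq_nonneg ‖S₂ y‖, mul_nonneg (sq_nonneg C) (sq_nonneg ‖c‖)]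
  let B : ℂ × ℂ → (H →L[ℂ] H) := fun w =>
    A - (w.1 - w₀.1) • adjoint S₁ - (w.2 - w₀.2) • adjoint S₂
  have hBan : ∀ w, AnalyticAt ℂ B w := fun w =>
    ((analyticAt_const.sub ((analyticAt_fst.sub analyticAt_const).smul analyticAt_const)).sub
      ((analyticAt_snd.sub analyticAt_const).smul analyticAt_const))
  have hB₀ : B w₀ = A := by simp [B]
  have hBu : ∀ᶠ w in nhds w₀, IsUnit (B w) :=
    (hBan w₀).continuousAt.eventually (Units.isOpen.mem_nhds (by simpa [hB₀] using hAunit))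
  obtain ⟨δ, hδ, hball⟩ := Metric.eventually_nhds_iff_ball.mp (hBu.and (hΩ.mem_nhds hw₀))
  refine ⟨δ, hδ, fun w => Ring.inverse (B w) v, fun w hw => ?_, fun w hw => (hball w hw).2,
    fun w hw => ?_⟩
  · obtain ⟨u, hu⟩ := (hball w hw).1
    have h1 : AnalyticAt ℂ (fun w => Ring.inverse (B w)) w :=
      AnalyticAt.fun_comp (by rw [← hu]; exact analyticAt_inverse u) (hBan w)
    exact (ContinuousLinearMap.apply ℂ H v).analyticAt _ |>.comp h1
  · have hinv : ∀ w ∈ Metric.ball w₀ δ, ∀ x, Ring.inverse (B w) (B w x) = x := fun w hw x => by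
      rw [← mul_apply_eq_comp, Ring.inverse_mul_cancel _ (hball w hw).1,
        one_apply_eq_self]
    have hinv' : B w (Ring.inverse (B w) v) = v := by
      rw [← mul_apply_eq_comp, Ring.mul_inverse_cancel _ (hball w hw).1,
        one_apply_eq_self]
    have hle : LinearMap.ker (dOp T w).toLinearMap ≤
        Submodule.span ℂ {Ring.inverse (B w) v} := fun x hx => by
      have hx' := mem_ker_dOp.mp hx
      have h1 : S₁ x = (w.1 - w₀.1) • x := by simp [hS₁, hx'.1, sub_smul]
      have h2 : S₂ x = (w.2 - w₀.2) • x := by simp [hS₂, hx'.2, sub_smul]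
      have h3 : B w x = inner ℂ v x • v := by
        simp only [B, sub_apply, smul_apply, hAx, h1, h2,
          map_smul]
        abel
      rw [Submodule.mem_span_singleton]
      exact ⟨inner ℂ v x, by rw [← map_smul, ← h3, hinv w hw]⟩
    have hγ₀ : Ring.inverse (B w₀) v = v := by
      have : B w₀ v = v := by rw [hB₀, hAx, hSv.1, hSv.2, hvv]; simp
      conv_lhs => rw [← this]
      exact hinv w₀ (Metric.mem_ball_self hδ) v
    refine ⟨?_, ?_⟩
    -- The kernel has dimension exactly one and sits in a span of dimension at most one.
    · have : FiniteDimensional ℂ (Submodule.span ℂ {Ring.inverse (B w) v}) := inferInstance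
      refine Submodule.eq_of_le_of_finrank_le hle ?_
      rw [hT.finrank_ker w (hball w hw).2]
      exact (finrank_span_le_card _).trans (by simp)
    · beta_reduce
      rw [hγ₀]
      set g := Ring.inverse (B w) v
      -- Since `S₁ v = S₂ v = 0`, pairing with `v` kills every term of `B w` except the rank one
      -- term.
      have h1 : inner ℂ v (B w g) = inner ℂ v g := by
        simp only [B, sub_apply, smul_apply, hAx,
          inner_sub_right, inner_add_right, inner_smul_right, adjoint_inner_right, hSv.1, hSv.2,
          inner_zero_left, hvv]
        ring
      rw [← h1, hinv', hvv]

/-- A vector that is orthogonal to the joint eigenvectors at all points near one point of the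
domain is zero. -/
theorem CowenDouglas.eq_zero_of_eventually_inner_eq_zero [CompleteSpace H]
    {T : (H →L[ℂ] H) × (H →L[ℂ] H)} {Ω : Set (ℂ × ℂ)} (hΩ : IsOpen Ω) (hc : IsPreconnected Ω)
    (hT : CowenDouglas T Ω) {w₀ : ℂ × ℂ} (hw₀ : w₀ ∈ Ω) {h : H}
    (hh : ∀ᶠ w in nhds w₀, ∀ x ∈ LinearMap.ker (dOp T w).toLinearMap, inner ℂ h x = 0) :
    h = 0 := by
  let u : Set (ℂ × ℂ) :=
    {p | ∀ᶠ w in nhds p, ∀ x ∈ LinearMap.ker (dOp T w).toLinearMap, inner ℂ h x = 0}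
  have hu : IsOpen u := isOpen_setOfPred_eventually_nhds
  have hsub : Ω ⊆ u := by
    -- The open set `u` is also relatively closed in `Ω`: on a ball around a limit point, `⟨h, γ w⟩`
    -- is analytic and vanishes near some point, hence throughout.
    refine hc.subset_of_closure_inter_subset hu ⟨w₀, hw₀, hh⟩ fun p hp => ?_
    obtain ⟨δ, hδ, γ, hγ, -, hγk⟩ := hT.exists_frame hΩ hp.2
    obtain ⟨q, hqb, hqu⟩ := mem_closure_iff_nhds.mp hp.1 _ (Metric.ball_mem_nhds p hδ)
    have hin : ∀ w ∈ Metric.ball p δ, γ w ∈ LinearMap.ker (dOp T w).toLinearMap := fun w hw =>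
      (hγk w hw).1 ▸ Submodule.mem_span_singleton_self _
    have han : AnalyticOnNhd ℂ (fun w => inner ℂ h (γ w)) (Metric.ball p δ) := fun w hw =>
      ((innerSL ℂ h).analyticAt _).comp (hγ w hw)
    have hz := han.eqOn_zero_of_preconnected_of_eventuallyEq_zero
      (convex_ball p δ).isPreconnected hqb (by
        filter_upwards [show ∀ᶠ w in nhds q, _ from hqu, Metric.isOpen_ball.mem_nhds hqb]
          with w hw hwb using hw _ (hin w hwb))
    filter_upwards [Metric.ball_mem_nhds p hδ] with w hw x hx
    rw [(hγk w hw).1] at hx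
    obtain ⟨c, rfl⟩ := Submodule.mem_span_singleton.mp hx
    have := hz hw
    rw [inner_smul_right]
    simp only [Pi.zero_apply] at this
    rw [this, mul_zero]
  refine hT.dense_span.eq_zero_of_inner_right ℂ fun x hx => ?_
  have hle : (⨆ w ∈ Ω, LinearMap.ker (dOp T w).toLinearMap : Submodule ℂ H) ≤
      LinearMap.ker (innerSL ℂ h).toLinearMap :=
    iSup₂_le fun w hw y hy => (hsub hw).self_of_nhds y hy
  rw [← inner_conj_symm, show inner ℂ h x = 0 from hle hx, map_zero]

end Frame

/-! ### A functional equation that characterizes `(1 - t)^{-l}` -/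

section FunctionalEquation

open Metric

/-- Identity theorem: the positive reals accumulate at the centre of the disc. -/
lemma eqOn_ball_of_eq_ofReal {ρ : ℝ} (hρ : 0 < ρ) {f g : ℂ → ℂ}
    (hf : DifferentiableOn ℂ f (ball 0 ρ)) (hg : DifferentiableOn ℂ g (ball 0 ρ))
    (h : ∀ t : ℝ, 0 < t → t < ρ → f t = g t) : Set.EqOn f g (ball 0 ρ) := by
  refine (hf.analyticOnNhd isOpen_ball).eqOn_of_preconnected_of_mem_closure
    (hg.analyticOnNhd isOpen_ball) (convex_ball 0 ρ).isPreconnected (mem_ball_self hρ) ?_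
  have h1 : Filter.Tendsto (fun t : ℝ => (t : ℂ)) (nhdsWithin 0 (Set.Ioi 0)) (nhds (0 : ℂ)) :=
    (Complex.continuous_ofReal.tendsto' 0 0 Complex.ofReal_zero).mono_left nhdsWithin_le_nhds
  refine mem_closure_of_tendsto h1 ?_
  filter_upwards [Ioo_mem_nhdsGT hρ] with t ht
  exact ⟨h t ht.1 ht.2, by simpa using ht.1.ne'⟩

lemma one_sub_mem_slitPlane {t : ℂ} (ht : ‖t‖ < 1) : 1 - t ∈ Complex.slitPlane := by
  rw [sub_eq_add_neg]
  exact Complex.mem_slitPlane_of_norm_lt_one (by rwa [norm_neg])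

/-- The differential equation says that `f t * (1 - t) ^ l` has derivative zero. -/
lemma eq_one_sub_cpow_of_deriv {ρ : ℝ} (hρ : 0 < ρ) (hρ1 : ρ ≤ 1) {f : ℂ → ℂ} {l : ℂ}
    (hf : DifferentiableOn ℂ f (ball 0 ρ)) (h0 : f 0 = 1)
    (h : ∀ t ∈ ball (0 : ℂ) ρ, deriv f t * (1 - t) = l * f t) :
    ∀ t ∈ ball (0 : ℂ) ρ, f t = (1 - t) ^ (-l) := by
  have hs : ∀ t ∈ ball (0 : ℂ) ρ, 1 - t ∈ Complex.slitPlane := fun t ht =>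
    one_sub_mem_slitPlane ((mem_ball_zero_iff.mp ht).trans_le hρ1)
  have hd : ∀ t ∈ ball (0 : ℂ) ρ, HasDerivAt (fun t => f t * (1 - t) ^ l) 0 t := fun t ht => by
    have h1 : HasDerivAt f (deriv f t) t :=
      (hf.differentiableAt (isOpen_ball.mem_nhds ht)).hasDerivAt
    have h2 : HasDerivAt (fun t : ℂ => (1 - t) ^ l) (l * (1 - t) ^ (l - 1) * (-1)) t :=
      ((hasDerivAt_id t).const_sub 1).cpow_const (hs t ht)
    refine (h1.mul h2).congr_deriv ?_
    have h3 : (1 - t) ^ l = (1 - t) ^ (l - 1) * (1 - t) := by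
      rw [Complex.cpow_sub _ _ (Complex.slitPlane_ne_zero (hs t ht)), Complex.cpow_one,
        div_mul_cancel₀ _ (Complex.slitPlane_ne_zero (hs t ht))]
    rw [h3]
    linear_combination (1 - t) ^ (l - 1) * h t ht
  intro t ht
  have hc := (convex_ball (0 : ℂ) ρ).is_const_of_fderivWithin_eq_zero (𝕜 := ℂ)
    (fun t ht => (hd t ht).differentiableAt.differentiableWithinAt)
    (fun t ht => by
      rw [fderivWithin_of_isOpen isOpen_ball ht]
      simpa using (hd t ht).hasFDerivAt.fderiv) ht (mem_ball_self hρ)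
  simp only [sub_zero, Complex.one_cpow, h0, mul_one] at hc
  rw [Complex.cpow_neg]
  exact eq_inv_of_mul_eq_one_left hc

/-- Differentiating the functional equation at `w = 0`, with `t = a²`, gives `f' (t) (1 - t) = f'
(0) f (t)` for positive `t`, hence on the disc. The exponent is `f' (0)`: real because `f` is real
on positive reals, and positive because `f` exceeds 1 there. -/
lemma exists_eq_one_sub_cpow {ρ : ℝ} (hρ : 0 < ρ) (hρ1 : ρ ≤ 1) {f : ℂ → ℂ}
    (hf : DifferentiableOn ℂ f (ball 0 ρ)) (h0 : f 0 = 1)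
    (heq : ∀ a : ℝ, 0 < a → a ^ 2 < ρ → ∀ᶠ w : ℂ in nhds 0,
      f ((a : ℂ) ^ 2) = f (a * w) * f ((a ^ 2 - a * w) / (1 - a * w)))
    (hre : ∀ t : ℝ, 0 < t → t < ρ → (f t).im = 0 ∧ 1 < (f t).re) :
    ∃ l : ℝ, 0 < l ∧ ∀ t ∈ ball (0 : ℂ) ρ, f t = (1 - t) ^ (-(l : ℂ)) := by
  have hfd : ∀ t ∈ ball (0 : ℂ) ρ, HasDerivAt f (deriv f t) t := fun t ht =>
    (hf.differentiableAt (isOpen_ball.mem_nhds ht)).hasDerivAt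
  have hb : ∀ t : ℝ, 0 < t → t < ρ → (t : ℂ) ∈ ball (0 : ℂ) ρ := fun t h1 h2 => by
    rwa [mem_ball_zero_iff, Complex.norm_real, Real.norm_of_nonneg h1.le]
  have hreal : ∀ t : ℝ, 0 < t → t < ρ → deriv f t * (1 - t) = deriv f 0 * f t := by
    intro t ht htρ
    set a := Real.sqrt t with ha
    have ha0 : 0 < a := Real.sqrt_pos.mpr ht
    have hat : a ^ 2 = t := Real.sq_sqrt ht.le
    have hat' : (a : ℂ) ^ 2 = t := by exact_mod_cast hat
    have h1 : HasDerivAt (fun w : ℂ => (a : ℂ) * w) a 0 := by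
      simpa using (hasDerivAt_id (0 : ℂ)).const_mul (a : ℂ)
    have h2 : HasDerivAt (fun w : ℂ => ((a : ℂ) ^ 2 - a * w) / (1 - a * w))
        (-(a : ℂ) + a * t) 0 := by
      have := (h1.const_sub ((a : ℂ) ^ 2)).div (h1.const_sub 1) (by simp)
      refine this.congr_deriv ?_
      simp only [hat']
      ring
    have h3 : HasDerivAt (fun w : ℂ => f (a * w)) (deriv f 0 * a) 0 :=
      HasDerivAt.comp (h₂ := f) 0 (by simpa using hfd 0 (mem_ball_self hρ)) h1
    have h4 : HasDerivAt (fun w : ℂ => f (((a : ℂ) ^ 2 - a * w) / (1 - a * w)))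
        (deriv f t * (-a + a * t)) 0 :=
      HasDerivAt.comp (h₂ := f) 0 (by simpa [hat'] using hfd t (hb t ht htρ)) h2
    -- The product is constant in `w`, so its derivative at `0` vanishes.
    have h5 := (h3.mul h4).congr_of_eventuallyEq (heq a ha0 (by rwa [hat]))
    have h6 := h5.unique (hasDerivAt_const (0 : ℂ) (f ((a : ℂ) ^ 2)))
    simp only [mul_zero, sub_zero, div_one, h0, hat', one_mul] at h6
    have ha' : (a : ℂ) ≠ 0 := by exact_mod_cast ha0.ne'
    refine mul_left_cancel₀ ha' ?_
    linear_combination -h6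
  have hode := eqOn_ball_of_eq_ofReal hρ (f := fun t => deriv f t * (1 - t))
    (g := fun t => deriv f 0 * f t)
    ((hf.deriv isOpen_ball).mul (by fun_prop)) (hf.const_mul _) hreal
  have hform := eq_one_sub_cpow_of_deriv hρ hρ1 hf h0 hode
  have him : (deriv f 0).im = 0 := by
    have h1 : HasDerivAt (fun t : ℝ => f t) (deriv f 0) 0 :=
      HasDerivAt.comp_ofReal (by simpa using hfd 0 (mem_ball_self hρ))
    have h2 := (Complex.continuous_im.tendsto _).comp h1.tendsto_slope_zero_right
    refine tendsto_nhds_unique h2 (Filter.Tendsto.congr' ?_ tendsto_const_nhds)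
    filter_upwards [Ioo_mem_nhdsGT hρ] with t ht
    simp [h0, (hre t ht.1 ht.2).1]
  have hl : deriv f 0 = ((deriv f 0).re : ℂ) := Complex.ext rfl (by simpa using him)
  rw [hl] at hform
  refine ⟨(deriv f 0).re, ?_, hform⟩
  by_contra hneg
  have hρ2 : 0 < ρ / 2 ∧ ρ / 2 < ρ := ⟨by linarith, by linarith⟩
  have h1 := (hre (ρ / 2) hρ2.1 hρ2.2).2
  rw [hform _ (hb _ hρ2.1 hρ2.2)] at h1
  have h2 : (1 - ((ρ / 2 : ℝ) : ℂ)) ^ (-((deriv f 0).re : ℂ)) =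
      (((1 - ρ / 2) ^ (-(deriv f 0).re) : ℝ) : ℂ) := by
    rw [Complex.ofReal_cpow (by linarith)]
    push_cast
    rfl
  rw [h2, Complex.ofReal_re] at h1
  exact absurd h1 (not_lt.mpr (Real.rpow_le_one (by linarith) (by linarith) (by linarith)))

end FunctionalEquation

/-! ### Kernels that are invariant under the Möbius group -/

section Kernel

open Metric

/-- The automorphism `w ↦ (w - a) / (1 - ā w)` of the disc. -/
def discAut (a w : ℂ) : ℂ := (w - a) / (1 - conj a * w)

variable {H : Type*} [NormedAddCommGroup H] [InnerProductSpace ℂ H]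

lemma mk_mem_ball {ε : ℝ} {x y : ℂ} (hx : ‖x‖ < ε) (hy : ‖y‖ < ε) :
    (x, y) ∈ ball (0 : ℂ × ℂ) ε := by
  rw [mem_ball_zero_iff, Prod.norm_mk]
  exact max_lt hx hy

lemma norm_lt_of_mem_ball {ε : ℝ} {z : ℂ × ℂ} (hz : z ∈ ball (0 : ℂ × ℂ) ε) :
    ‖z.1‖ < ε ∧ ‖z.2‖ < ε := by
  rw [mem_ball_zero_iff] at hz
  exact ⟨(norm_fst_le z).trans_lt hz, (norm_snd_le z).trans_lt hz⟩

lemma norm_mul_lt_of_le_one {ε : ℝ} {c x : ℂ} (hc : ‖c‖ ≤ 1) (hx : ‖x‖ < ε) : ‖c * x‖ < ε := by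
  rw [norm_mul]
  exact (mul_le_of_le_one_left (norm_nonneg x) hc).trans_lt hx

/-- A kernel that is invariant under the torus depends on the products of the coordinates
only. -/
lemma inner_mul_eq_of_torus_invariant {γ : ℂ × ℂ → H} {ε : ℝ}
    (hγ : DifferentiableOn ℂ γ (ball 0 ε))
    (ht : ∀ c₁ c₂ : ℂ, ‖c₁‖ = 1 → ‖c₂‖ = 1 → ∀ z ∈ ball (0 : ℂ × ℂ) ε, ∀ w ∈ ball (0 : ℂ × ℂ) ε,
      inner ℂ (γ (c₁ * z.1, c₂ * z.2)) (γ (c₁ * w.1, c₂ * w.2)) = inner ℂ (γ z) (γ w))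
    {z w : ℂ × ℂ} (hz : z ∈ ball (0 : ℂ × ℂ) ε) (hw : w ∈ ball (0 : ℂ × ℂ) ε) {c₁ c₂ : ℂ}
    (hc₁ : ‖c₁‖ ≤ 1) (hc₂ : ‖c₂‖ ≤ 1) :
    inner ℂ (γ z) (γ (c₁ * w.1, c₂ * w.2)) =
      inner ℂ (γ (conj c₁ * z.1, conj c₂ * z.2)) (γ w) := by
  obtain ⟨hz₁, hz₂⟩ := norm_lt_of_mem_ball hz
  obtain ⟨hw₁, hw₂⟩ := norm_lt_of_mem_ball hw
  have hγd : ∀ p ∈ ball (0 : ℂ × ℂ) ε, DifferentiableAt ℂ γ p := fun p hp =>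
    hγ.differentiableAt (isOpen_ball.mem_nhds hp)
  have hin : ∀ (x : H) (p : ℂ → ℂ × ℂ), Differentiable ℂ p →
      ∀ c, p c ∈ ball (0 : ℂ × ℂ) ε → DifferentiableAt ℂ (fun c => inner ℂ x (γ (p c))) c :=
    fun x p hp c hc => (innerSL ℂ x).differentiableAt.comp c ((hγd _ hc).comp c (hp c))
  have hin' : ∀ (x : H) (p : ℂ → ℂ × ℂ), Differentiable ℂ p →
      ∀ c, p (conj c) ∈ ball (0 : ℂ × ℂ) ε →
        DifferentiableAt ℂ (fun c => inner ℂ (γ (p (conj c))) x) c := fun x p hp c hc => by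
    have := (hin x p hp (conj c) hc).conj_conj
    simpa [Function.comp_def] using this
  have hconj : ∀ {c : ℂ}, ‖c‖ ≤ 1 → ‖conj c‖ ≤ 1 := fun h => by rwa [RCLike.norm_conj]
  -- Maximum principle: holomorphic functions that agree on the unit circle agree on the disc. It is
  -- used first in `c₁`, with `c₂` unimodular, and then in `c₂`. Both sides of the claim are
  -- holomorphic in these parameters, because the conjugate-linear slot carries `conj c`.
  have key : ∀ f g : ℂ → ℂ, (∀ c, ‖c‖ ≤ 1 → DifferentiableAt ℂ f c) →
      (∀ c, ‖c‖ ≤ 1 → DifferentiableAt ℂ g c) → (∀ c, ‖c‖ = 1 → f c = g c) →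
      ∀ c, ‖c‖ ≤ 1 → f c = g c := fun f g hf hg h c hc => by
    have hcl : closure (ball (0 : ℂ) 1) = closedBall 0 1 := closure_ball 0 one_ne_zero
    refine Complex.eqOn_closure_of_eqOn_frontier (U := ball (0 : ℂ) 1) isBounded_ball
      (DifferentiableOn.diffContOnCl fun c hc => ?_)
      (DifferentiableOn.diffContOnCl fun c hc => ?_) (fun c hc => ?_) ?_
    · rw [hcl] at hc
      exact (hf c (mem_closedBall_zero_iff.mp hc)).differentiableWithinAt
    · rw [hcl] at hc
      exact (hg c (mem_closedBall_zero_iff.mp hc)).differentiableWithinAt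
    · rw [frontier_ball (0 : ℂ) one_ne_zero] at hc
      exact h c (mem_sphere_zero_iff_norm.mp hc)
    · rw [hcl]
      exact mem_closedBall_zero_iff.mpr hc
  have hunit : ∀ c : ℂ, ‖c‖ = 1 → ∀ x, c * (conj c * x) = x := fun c hc x => by
    rw [← mul_assoc, Complex.mul_conj, Complex.normSq_eq_norm_sq, hc]
    simp
  have hfst : ∀ d, ‖d‖ = 1 → ∀ c, ‖c‖ ≤ 1 → inner ℂ (γ z) (γ (c * w.1, d * w.2)) =
      inner ℂ (γ (conj c * z.1, conj d * z.2)) (γ w) := fun d hd => by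
    refine key _ _ (fun c hc => hin (γ z) (fun c => (c * w.1, d * w.2)) (by fun_prop) c
      (mk_mem_ball (norm_mul_lt_of_le_one hc hw₁) (norm_mul_lt_of_le_one hd.le hw₂)))
      (fun c hc => hin' (γ w) (fun c => (c * z.1, conj d * z.2)) (by fun_prop) c
        (mk_mem_ball (norm_mul_lt_of_le_one (hconj hc) hz₁)
          (norm_mul_lt_of_le_one (hconj hd.le) hz₂))) fun c hc => ?_
    -- On the torus the claim is the invariance applied to the point `(c̄ z₁, d̄ z₂)`, which the
    -- rotation carries to `z`.
    have := ht c d hc hd (conj c * z.1, conj d * z.2)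
      (mk_mem_ball (norm_mul_lt_of_le_one (hconj hc.le) hz₁)
          (norm_mul_lt_of_le_one (hconj hd.le) hz₂)) w hw
    rw [← this, hunit c hc, hunit d hd]
  refine key (fun d => inner ℂ (γ z) (γ (c₁ * w.1, d * w.2)))
    (fun d => inner ℂ (γ (conj c₁ * z.1, conj d * z.2)) (γ w))
    (fun d hd => hin (γ z) (fun d => (c₁ * w.1, d * w.2)) (by fun_prop) d
      (mk_mem_ball (norm_mul_lt_of_le_one hc₁ hw₁) (norm_mul_lt_of_le_one hd hw₂)))
    (fun d hd => hin' (γ w) (fun d => (conj c₁ * z.1, d * z.2)) (by fun_prop) d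
      (mk_mem_ball (norm_mul_lt_of_le_one (hconj hc₁) hz₁)
          (norm_mul_lt_of_le_one (hconj hd) hz₂))) (fun d hd => hfst d hd c₁ hc₁) c₂ hc₂

/-- A kernel on a small bidisc, normalized at the origin, that is invariant under the torus and
transforms under the automorphisms of the bidisc like a homogeneous kernel is of the form
`(1 - t₁)^{-l} (1 - t₂)^{-m}`. -/
theorem exists_inner_eq_discKernel {γ : ℂ × ℂ → H} {ε : ℝ} (hε : 0 < ε) (hε1 : ε ≤ 1)
    (hγ : DifferentiableOn ℂ γ (ball 0 ε))
    (h0 : ∀ w ∈ ball (0 : ℂ × ℂ) ε, inner ℂ (γ 0) (γ w) = 1)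
    (hne : ∀ w ∈ ball (0 : ℂ × ℂ) ε, w ≠ 0 → γ w ≠ γ 0)
    (ht : ∀ c₁ c₂ : ℂ, ‖c₁‖ = 1 → ‖c₂‖ = 1 → ∀ z ∈ ball (0 : ℂ × ℂ) ε, ∀ w ∈ ball (0 : ℂ × ℂ) ε,
      inner ℂ (γ (c₁ * z.1, c₂ * z.2)) (γ (c₁ * w.1, c₂ * w.2)) = inner ℂ (γ z) (γ w))
    (hm : ∀ a ∈ ball (0 : ℂ × ℂ) ε, ∀ w ∈ ball (0 : ℂ × ℂ) ε,
      (discAut a.1 w.1, discAut a.2 w.2) ∈ ball (0 : ℂ × ℂ) ε →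
      inner ℂ (γ a) (γ a) =
        inner ℂ (γ a) (γ w) * inner ℂ (γ (-a)) (γ (discAut a.1 w.1, discAut a.2 w.2))) :
    ∃ l m : ℝ≥0, 0 < l ∧ 0 < m ∧ ∃ r > 0, ∀ z ∈ ball (0 : ℂ × ℂ) r, ∀ w ∈ ball (0 : ℂ × ℂ) r,
      inner ℂ (γ z) (γ w) = discKernel l w.1 z.1 * discKernel m w.2 z.2 := by
  set r := ε / 2 with hr
  have hr0 : 0 < r := by positivity
  have hrε : r < ε := by linarith
  have hrc : (r : ℂ) ≠ 0 := by exact_mod_cast hr0.ne'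
  have hrn : ‖(r : ℂ)‖ = r := by rw [Complex.norm_real, Real.norm_of_nonneg hr0.le]
  set ρ := r ^ 2 with hρ
  have hρ0 : 0 < ρ := by positivity
  have hρ1 : ρ ≤ 1 := by rw [hρ]; nlinarith
  -- The base point `(r, r)` has nonzero coordinates, so every `z` with `|zᵢ| ≤ r` is a contraction
  -- of it; moving the contraction to the other slot gives `hNF`. Taking `r < ε` leaves `s / r` in
  -- the domain for `|s| < r²`.
  let F : ℂ → ℂ → ℂ := fun s t => inner ℂ (γ (r, r)) (γ (s / r, t / r))
  have hdiv : ∀ t : ℂ, ‖t‖ < ρ → ‖t / r‖ < ε := fun t h => by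
    rw [norm_div, hrn, div_lt_iff₀ hr0]
    refine h.trans ?_
    rw [hρ]; nlinarith
  have hNF : ∀ z w : ℂ × ℂ, ‖z.1‖ ≤ r → ‖z.2‖ ≤ r → w ∈ ball (0 : ℂ × ℂ) ε →
      inner ℂ (γ z) (γ w) = F (conj z.1 * w.1) (conj z.2 * w.2) := fun z w hz₁ hz₂ hw => by
    have hn : ∀ x : ℂ, ‖x‖ ≤ r → ‖conj x / r‖ ≤ 1 := fun x hx => by
      rw [norm_div, RCLike.norm_conj, hrn]; exact div_le_one_of_le₀ hx hr0.le
    have h := inner_mul_eq_of_torus_invariant hγ ht (z := (r, r)) (w := w)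
      (mk_mem_ball (by rwa [hrn]) (by rwa [hrn])) hw (hn _ hz₁) (hn _ hz₂)
    have hcz : ∀ x : ℂ, conj (conj x / r) * r = x := fun x => by
      rw [map_div₀, Complex.conj_conj, Complex.conj_ofReal, div_mul_cancel₀ _ hrc]
    simp only [hcz] at h
    rw [← h]
    simp only [F, div_mul_eq_mul_div]
  have hFd : ∀ p q : ℂ → ℂ, Differentiable ℂ p → Differentiable ℂ q → ∀ t, ‖p t‖ < ρ → ‖q t‖ < ρ →
      DifferentiableAt ℂ (fun t => F (p t) (q t)) t := fun p q hp hq t h1 h2 => by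
    have hd : DifferentiableAt ℂ γ (p t / r, q t / r) :=
      hγ.differentiableAt (isOpen_ball.mem_nhds (mk_mem_ball (hdiv _ h1) (hdiv _ h2)))
    have hpq : DifferentiableAt ℂ (fun t => (p t / (r : ℂ), q t / (r : ℂ))) t :=
      ((hp t).div_const _).prodMk ((hq t).div_const _)
    exact (innerSL ℂ (γ (r, r))).differentiableAt.comp t
      (DifferentiableAt.comp (g := γ) t hd hpq)
  have hF00 : F 0 0 = 1 := by
    have h00 : (0 : ℂ × ℂ) ∈ ball (0 : ℂ × ℂ) ε := mem_ball_self hε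
    have := hNF 0 0 (by simpa using hr0.le) (by simpa using hr0.le) h00
    rw [h0 0 h00] at this
    simpa using this.symm
  have hsq : ∀ t : ℝ, 0 ≤ t → t < ρ → ∃ a : ℝ, 0 ≤ a ∧ a < r ∧ a ^ 2 = t := fun t h1 h2 =>
    ⟨Real.sqrt t, Real.sqrt_nonneg _, by
      rw [Real.sqrt_lt' hr0]; exact h2, Real.sq_sqrt h1⟩
  have hnr : ∀ a : ℝ, 0 ≤ a → ‖(a : ℂ)‖ = a := fun a h => by
    rw [Complex.norm_real, Real.norm_of_nonneg h]
  have hmF : ∀ a b : ℝ, 0 ≤ a → a < r → 0 ≤ b → b < r → ∀ w ∈ ball (0 : ℂ × ℂ) ε,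
      (discAut a w.1, discAut b w.2) ∈ ball (0 : ℂ × ℂ) ε →
      F (a ^ 2) (b ^ 2) = F (a * w.1) (b * w.2) * F (-a * discAut a w.1) (-b * discAut b w.2) := by
    intro a b ha har hb hbr w hw hσ
    have hab : ((a : ℂ), (b : ℂ)) ∈ ball (0 : ℂ × ℂ) ε :=
      mk_mem_ball (by rw [hnr a ha]; linarith) (by rw [hnr b hb]; linarith)
    have h := hm (a, b) hab w hw hσ
    rw [hNF (a, b) (a, b) (by rw [hnr a ha]; exact har.le) (by rw [hnr b hb]; exact hbr.le) hab,
      hNF (a, b) w (by rw [hnr a ha]; exact har.le) (by rw [hnr b hb]; exact hbr.le) hw,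
      hNF (-((a : ℂ), (b : ℂ))) _ (by simpa [hnr a ha, abs_of_nonneg ha] using har.le)
        (by simpa [hnr b hb, abs_of_nonneg hb] using hbr.le) hσ] at h
    simpa [sq] using h
  have hself : ∀ a : ℝ, discAut a a = 0 := fun a => by simp [discAut]
  have hzero : ∀ a : ℝ, discAut a 0 = -a := fun a => by simp [discAut]
  -- The choice `w = (a, 0)` separates the variables, because the automorphism sends `a` to `0` in
  -- the first coordinate and `0` to `-b` in the second.
  have hprodr : ∀ s t : ℝ, 0 < s → s < ρ → 0 < t → t < ρ → F s t = F s 0 * F 0 t := by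
    intro s t hs hsρ ht htρ
    obtain ⟨a, ha, har, rfl⟩ := hsq s hs.le hsρ
    obtain ⟨b, hb, hbr, rfl⟩ := hsq t ht.le htρ
    have h := hmF a b ha har hb hbr (a, 0)
      (mk_mem_ball (by rw [hnr a ha]; linarith) (by simpa using hε)) (by
        simp only [hself, hzero]
        exact mk_mem_ball (by simpa using hε) (by rw [norm_neg, hnr b hb]; linarith))
    simp only [hself, hzero, mul_zero, neg_mul_neg] at h
    simpa [sq] using h
  have hprod : ∀ s t : ℂ, ‖s‖ < ρ → ‖t‖ < ρ → F s t = F s 0 * F 0 t := by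
    have hz : ‖(0 : ℂ)‖ < ρ := by simpa using hρ0
    have h1 : ∀ t : ℝ, 0 < t → t < ρ → ∀ s : ℂ, ‖s‖ < ρ → F s t = F s 0 * F 0 t :=
      fun t ht htρ s hs => eqOn_ball_of_eq_ofReal hρ0 (f := fun s => F s t)
        (g := fun s => F s 0 * F 0 t)
        (fun s hs => (hFd id (fun _ => t) differentiable_id (differentiable_const _) s
          (mem_ball_zero_iff.mp hs) (by rwa [hnr t ht.le])).differentiableWithinAt)
        (fun s hs => ((hFd id (fun _ => 0) differentiable_id (differentiable_const _) s
          (mem_ball_zero_iff.mp hs) hz).mul_const _).differentiableWithinAt)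
        (fun s hs hsρ => hprodr s t hs hsρ ht htρ) (mem_ball_zero_iff.mpr hs)
    intro s t hs ht
    exact eqOn_ball_of_eq_ofReal hρ0 (f := fun t => F s t) (g := fun t => F s 0 * F 0 t)
        (fun t ht => (hFd (fun _ => s) id (differentiable_const _) differentiable_id t
          hs (mem_ball_zero_iff.mp ht)).differentiableWithinAt)
        (fun t ht => ((hFd (fun _ => 0) id (differentiable_const _) differentiable_id t
          hz (mem_ball_zero_iff.mp ht)).const_mul _).differentiableWithinAt)
        (fun t ht htρ => h1 t ht htρ s hs) (mem_ball_zero_iff.mpr ht)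
  have hz : ‖(0 : ℂ)‖ < ρ := by simpa using hρ0
  -- By the normalization, `‖γ w - γ 0‖² = ‖γ w‖² - 1`.
  have hgt : ∀ w ∈ ball (0 : ℂ × ℂ) ε, w ≠ 0 →
      (inner ℂ (γ w) (γ w)).im = 0 ∧ 1 < (inner ℂ (γ w) (γ w)).re := fun w hw hw0 => by
    have h00 := h0 0 (mem_ball_self hε)
    have h1 : 0 < (inner ℂ (γ w - γ 0) (γ w - γ 0)).re := by
      rw [← RCLike.re_eq_complex_re, inner_self_eq_norm_sq (𝕜 := ℂ)]
      exact pow_pos (norm_pos_iff.mpr (sub_ne_zero.mpr (hne w hw hw0))) 2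
    have h2 : inner ℂ (γ w) (γ 0) = 1 := by rw [← inner_conj_symm, h0 w hw, map_one]
    rw [inner_sub_left, inner_sub_right, inner_sub_right, h0 w hw, h00, h2] at h1
    refine ⟨inner_self_im (𝕜 := ℂ) (γ w), ?_⟩
    simp only [Complex.sub_re, Complex.one_re] at h1
    linarith
  have hcont : ∀ a : ℝ, 0 ≤ a → a < r → ∀ᶠ w : ℂ in nhds 0, ‖w‖ < ε ∧ ‖discAut a w‖ < ε := by
    intro a ha har
    have hc : ContinuousAt (fun w => discAut a w) 0 := by
      unfold discAut
      exact ContinuousAt.div (by fun_prop) (by fun_prop) (by simp)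
    refine Filter.Eventually.and ?_ ?_
    · filter_upwards [ball_mem_nhds (0 : ℂ) hε] with w hw using mem_ball_zero_iff.mp hw
    · refine hc.norm.eventually_lt continuousAt_const ?_
      rw [hzero, norm_neg, hnr a ha]
      linarith
  have haut : ∀ (a : ℝ) (w : ℂ), -a * discAut a w = (a ^ 2 - a * w) / (1 - a * w) := by
    intro a w
    rw [discAut, Complex.conj_ofReal, ← mul_div_assoc]
    congr 1
    ring
  have hzz : discAut ((0 : ℝ) : ℂ) 0 = 0 := by simp [discAut]
  have hlt : ∀ a : ℝ, 0 < a → a ^ 2 < ρ → a < r := fun a ha h => lt_of_pow_lt_pow_left₀ 2 hr0.le h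
  -- With the other coordinate of `a` and `w` equal to `0`, the transformation rule becomes the
  -- functional equation in one variable.
  obtain ⟨l, hl0, hl⟩ := exists_eq_one_sub_cpow hρ0 hρ1 (f := fun t => F t 0)
    (fun t ht => (hFd id (fun _ => 0) differentiable_id (differentiable_const _) t
          (mem_ball_zero_iff.mp ht) hz).differentiableWithinAt) hF00 (fun a ha haρ => by
      have har := hlt a ha haρ
      filter_upwards [hcont a ha.le har] with w hw
      have h := hmF a 0 ha.le har le_rfl hr0 (w, 0) (mk_mem_ball hw.1 (by simpa using hε))
        (mk_mem_ball hw.2 (by simpa only [hzz, norm_zero] using hε))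
      simp only [haut] at h
      simpa using h) (fun t ht htρ => by
      obtain ⟨a, ha, har, rfl⟩ := hsq t ht.le htρ
      have hab : ((a : ℂ), (0 : ℂ)) ∈ ball (0 : ℂ × ℂ) ε :=
        mk_mem_ball (by rw [hnr a ha]; linarith) (by simpa using hε)
      have ha0 : a ≠ 0 := by rintro rfl; simp at ht
      have h := hgt _ hab (by simpa using ha0)
      rw [hNF (a, 0) (a, 0) (by rw [hnr a ha]; exact har.le) (by simpa using hr0.le) hab] at h
      simpa [sq] using h)
  obtain ⟨m, hm0, hm⟩ := exists_eq_one_sub_cpow hρ0 hρ1 (f := fun t => F 0 t)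
    (fun t ht => (hFd (fun _ => 0) id (differentiable_const _) differentiable_id t
          hz (mem_ball_zero_iff.mp ht)).differentiableWithinAt) hF00 (fun a ha haρ => by
      have har := hlt a ha haρ
      filter_upwards [hcont a ha.le har] with w hw
      have h := hmF 0 a le_rfl hr0 ha.le har (0, w) (mk_mem_ball (by simpa using hε) hw.1)
        (mk_mem_ball (by simpa only [hzz, norm_zero] using hε) hw.2)
      simp only [haut] at h
      simpa using h) (fun t ht htρ => by
      obtain ⟨a, ha, har, rfl⟩ := hsq t ht.le htρ
      have hab : ((0 : ℂ), (a : ℂ)) ∈ ball (0 : ℂ × ℂ) ε :=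
        mk_mem_ball (by simpa using hε) (by rw [hnr a ha]; linarith)
      have ha0 : a ≠ 0 := by rintro rfl; simp at ht
      have h := hgt _ hab (by simpa using ha0)
      rw [hNF (0, a) (0, a) (by simpa using hr0.le) (by rw [hnr a ha]; exact har.le) hab] at h
      simpa [sq] using h)
  refine ⟨l.toNNReal, m.toNNReal, Real.toNNReal_pos.mpr hl0, Real.toNNReal_pos.mpr hm0, r,
    hr0, fun z hz w hw => ?_⟩
  obtain ⟨hz₁, hz₂⟩ := norm_lt_of_mem_ball hz
  obtain ⟨hw₁, hw₂⟩ := norm_lt_of_mem_ball hw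
  have hnm : ∀ x y : ℂ, ‖x‖ < r → ‖y‖ < r → ‖conj x * y‖ < ρ := fun x y hx hy => by
    rw [norm_mul, RCLike.norm_conj, hρ, sq]
    exact mul_lt_mul'' hx hy (norm_nonneg _) (norm_nonneg _)
  have h₁ := hnm _ _ hz₁ hw₁
  have h₂ := hnm _ _ hz₂ hw₂
  rw [hNF z w hz₁.le hz₂.le (ball_subset_ball hrε.le hw), hprod _ _ h₁ h₂]
  have e₁ := hl _ (mem_ball_zero_iff.mpr h₁)
  have e₂ := hm _ (mem_ball_zero_iff.mpr h₂)
  beta_reduce at e₁ e₂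
  rw [e₁, e₂, discKernel, discKernel, mul_comm w.1, mul_comm w.2, Real.coe_toNNReal _ hl0.le,
    Real.coe_toNNReal _ hm0.le]

end Kernel

/-! ### Joint eigenvectors of a homogeneous Hilbert module -/

section Homogeneous

open Metric

lemma openBidisc_eq_ball : openBidisc = ball (0 : ℂ × ℂ) 1 := ball_prod_same 0 0 1

lemma isOpen_openBidisc : IsOpen openBidisc := isOpen_ball.prod isOpen_ball

lemma isPreconnected_openBidisc : IsPreconnected openBidisc := by
  rw [openBidisc_eq_ball]
  exact (convex_ball _ _).isPreconnected

lemma zero_mem_openBidisc : (0 : ℂ × ℂ) ∈ openBidisc := by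
  rw [openBidisc_eq_ball]
  exact mem_ball_self one_pos

/-- The coordinatewise complex conjugation. -/
def conjPt (z : ℂ × ℂ) : ℂ × ℂ := (conj z.1, conj z.2)

@[simp]
lemma conjPt_conjPt (z : ℂ × ℂ) : conjPt (conjPt z) = z := by simp [conjPt]

@[simp]
lemma norm_conjPt (z : ℂ × ℂ) : ‖conjPt z‖ = ‖z‖ := by simp [conjPt, Prod.norm_def]

lemma conjPt_mem_openBidisc {z : ℂ × ℂ} (hz : z ∈ openBidisc) : conjPt z ∈ openBidisc := by
  rw [openBidisc_eq_ball, mem_ball_zero_iff] at *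
  rwa [norm_conjPt]

namespace HilbertModule

variable {H : Type*} [NormedAddCommGroup H] [InnerProductSpace ℂ H] (M : HilbertModule H)

lemma continuous_act (h : H) : Continuous fun f : algebra => M.act f h := by
  obtain ⟨C, hC, hb⟩ := M.bounded
  refine AddMonoidHomClass.continuous_of_bound
    ((LinearMap.applyₗ (R := ℂ) h).comp
      ((ContinuousLinearMap.coeLM ℂ).comp M.act.toLinearMap)) (C * ‖h‖) fun f => ?_
  exact (hb f h).trans_eq (by ring)

/-- The joint eigenspace of the adjoints of the coordinate multiplications that is attached to
the point `w`. -/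
def eigenspace [CompleteSpace H] (w : ℂ × ℂ) : Submodule ℂ H :=
  LinearMap.ker (dOp (ContinuousLinearMap.adjoint (M.act coord₁),
    ContinuousLinearMap.adjoint (M.act coord₂)) w).toLinearMap

variable [CompleteSpace H]

lemma mem_eigenspace {w : ℂ × ℂ} {x : H} : x ∈ M.eigenspace w ↔
    ContinuousLinearMap.adjoint (M.act coord₁) x = w.1 • x ∧
      ContinuousLinearMap.adjoint (M.act coord₂) x = w.2 • x := mem_ker_dOp

variable {M}

/-- The functions `f` that satisfy the identity form a closed subalgebra, and the eigenvalue
equations put both coordinates in it. The conjugate in the eigenvalue cancels the one from the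
conjugate-linear slot. -/
lemma inner_act_of_mem_eigenspace (z : openBidisc) {x : H} (hx : x ∈ M.eigenspace (conjPt z))
    (f : algebra) (h : H) :
    inner ℂ x (M.act f h) = (f : C(closedBidisc, ℂ)) (incl z) * inner ℂ x h := by
  obtain ⟨h₁, h₂⟩ := M.mem_eigenspace.mp hx
  let A : Subalgebra ℂ algebra :=
    { carrier := {f | ∀ h, inner ℂ x (M.act f h) =
        (f : C(closedBidisc, ℂ)) (incl z) * inner ℂ x h}
      mul_mem' := fun {f g} hf hg h => by
        rw [map_mul, mul_apply_eq_comp, hf, hg]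
        simp [mul_assoc]
      add_mem' := fun {f g} hf hg h => by
        rw [map_add, add_apply, inner_add_right, hf, hg]
        simp [add_mul]
      algebraMap_mem' := fun c h => by
        rw [AlgHom.commutes, Algebra.algebraMap_eq_smul_one, smul_apply, inner_smul_right]
        rfl }
  have hA : IsClosed (A : Set algebra) := by
    have : (A : Set algebra) = ⋂ h, {f | inner ℂ x (M.act f h) =
        (f : C(closedBidisc, ℂ)) (incl z) * inner ℂ x h} := by
      ext f
      rw [Set.mem_iInter]
      rfl
    rw [this]
    refine isClosed_iInter fun h => isClosed_eq (continuous_const.inner (M.continuous_act h)) ?_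
    exact (((continuous_eval_const (incl z)).comp continuous_subtype_val).mul
      continuous_const)
  have htop := eq_top_of_coord_mem hA (fun h => by
    rw [← ContinuousLinearMap.adjoint_inner_left, h₁, inner_smul_left]
    simp [conjPt, coord₁, incl]) (fun h => by
    rw [← ContinuousLinearMap.adjoint_inner_left, h₂, inner_smul_left]
    simp [conjPt, coord₂, incl])
  exact (htop ▸ Algebra.mem_top : f ∈ A) h

/-- On the eigenvector `x` the adjoint of the action of `f ∘ φ` has eigenvalue the conjugate of `f
(φ z)`; `U` carries this to the adjoint of the action of `f` on `U x`. -/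
lemma map_mem_eigenspace {φ : Mob × Mob} {U : H ≃ₗᵢ[ℂ] H}
    (hU : ∀ (f : algebra) (h : H), U ((M.pushforward φ).act f h) = M.act f (U h))
    (z : openBidisc) {x : H} (hx : x ∈ M.eigenspace (conjPt z)) :
    U x ∈ M.eigenspace (conjPt (mobMap φ z)) := by
  have key : ∀ f : algebra, ContinuousLinearMap.adjoint (M.act f) (U x) =
      conj ((f : C(closedBidisc, ℂ)) (mobC φ (incl z))) • U x := fun f => by
    refine ext_inner_right ℂ fun y => ?_
    obtain ⟨y, rfl⟩ := U.surjective y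
    rw [ContinuousLinearMap.adjoint_inner_left, ← hU, U.inner_map_map, inner_smul_left,
      U.inner_map_map, Complex.conj_conj]
    exact inner_act_of_mem_eigenspace z hx (compMob φ f) y
  rw [mem_eigenspace]
  exact ⟨key coord₁, key coord₂⟩

/-- A homogeneous module in `B₁(𝔻²)` has near the origin a holomorphic frame of joint
eigenvectors whose Gram kernel is of the form `(1 - t₁)^{-l} (1 - t₂)^{-m}`. -/
theorem exists_frame_inner_eq (hB : M.InB₁) (hM : M.IsHomogeneous) :
    ∃ l m : ℝ≥0, 0 < l ∧ 0 < m ∧ ∃ r > 0, r ≤ 1 ∧ ∃ γ : ℂ × ℂ → H,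
      ∀ z ∈ ball (0 : ℂ × ℂ) r, M.eigenspace z = Submodule.span ℂ {γ z} ∧
        ∀ w ∈ ball (0 : ℂ × ℂ) r,
          inner ℂ (γ z) (γ w) = discKernel l w.1 z.1 * discKernel m w.2 z.2 := by
  obtain ⟨δ, hδ, γ, hγ, -, hfr⟩ := CowenDouglas.exists_frame isOpen_openBidisc hB
    zero_mem_openBidisc
  set ε := min δ 1 with hεdef
  have hε : 0 < ε := lt_min hδ one_pos
  have hε1 : ε ≤ 1 := min_le_right _ _
  have hbδ : ball (0 : ℂ × ℂ) ε ⊆ ball 0 δ := ball_subset_ball (min_le_left _ _)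
  have hbo : ball (0 : ℂ × ℂ) ε ⊆ openBidisc := by
    rw [openBidisc_eq_ball]; exact ball_subset_ball hε1
  have hspan : ∀ w ∈ ball (0 : ℂ × ℂ) ε, M.eigenspace w = Submodule.span ℂ {γ w} :=
    fun w hw => (hfr w (hbδ hw)).1
  have h0 : ∀ w ∈ ball (0 : ℂ × ℂ) ε, inner ℂ (γ 0) (γ w) = 1 := fun w hw => (hfr w (hbδ hw)).2
  have h00 : (0 : ℂ × ℂ) ∈ ball (0 : ℂ × ℂ) ε := mem_ball_self hε
  have h0' : ∀ w ∈ ball (0 : ℂ × ℂ) ε, inner ℂ (γ w) (γ 0) = 1 := fun w hw => by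
    rw [← inner_conj_symm, h0 w hw, map_one]
  have hmem : ∀ w ∈ ball (0 : ℂ × ℂ) ε, γ w ∈ M.eigenspace w := fun w hw =>
    hspan w hw ▸ Submodule.mem_span_singleton_self _
  have hγ0 : γ 0 ≠ 0 := fun h => by simpa [h] using h0 0 h00
  have htrans : ∀ φ : Mob × Mob, ∃ U : H ≃ₗᵢ[ℂ] H, ∀ w ∈ ball (0 : ℂ × ℂ) ε,
      conjPt (mobMap φ (conjPt w)) ∈ ball (0 : ℂ × ℂ) ε →
        ∃ c : ℂ, U (γ w) = c • γ (conjPt (mobMap φ (conjPt w))) := fun φ => by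
    obtain ⟨U, hU⟩ := hM φ
    refine ⟨U, fun w hw hw' => ?_⟩
    have h := map_mem_eigenspace hU ⟨conjPt w, conjPt_mem_openBidisc (hbo hw)⟩
      (x := γ w) (by simpa using hmem w hw)
    rw [hspan _ hw', Submodule.mem_span_singleton] at h
    exact ⟨h.choose, h.choose_spec.symm⟩
  have hinner : ∀ (U : H ≃ₗᵢ[ℂ] H) {x y x' y' : H} {c d : ℂ}, U x = c • x' → U y = d • y' →
      inner ℂ x y = conj c * d * inner ℂ x' y' := fun U x y x' y' c d hx hy => by
    rw [← U.inner_map_map, hx, hy, inner_smul_left, inner_smul_right, mul_assoc]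
  suffices h : ∃ l m : ℝ≥0, 0 < l ∧ 0 < m ∧ ∃ r > 0, ∀ z ∈ ball (0 : ℂ × ℂ) r,
      ∀ w ∈ ball (0 : ℂ × ℂ) r,
        inner ℂ (γ z) (γ w) = discKernel l w.1 z.1 * discKernel m w.2 z.2 by
    obtain ⟨l, m, hl, hm, r, hr, hker⟩ := h
    refine ⟨l, m, hl, hm, min r ε, lt_min hr hε, (min_le_right _ _).trans hε1, γ, fun z hz =>
      ⟨hspan z (ball_subset_ball (min_le_right _ _) hz), fun w hw =>
        hker z (ball_subset_ball (min_le_left _ _) hz) w (ball_subset_ball (min_le_left _ _) hw)⟩⟩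
  refine exists_inner_eq_discKernel (γ := γ) hε hε1
    (fun w hw => (hγ w (hbδ hw)).differentiableAt.differentiableWithinAt) h0
    (fun w hw hw0 heq => hw0 ?_) (fun c₁ c₂ hc₁ hc₂ z hz w hw => ?_) (fun a ha w hw hσ => ?_)
  -- A nonzero vector cannot be a joint eigenvector for two different points.
  · obtain ⟨a₁, a₂⟩ := M.mem_eigenspace.mp (hmem w hw)
    obtain ⟨b₁, b₂⟩ := M.mem_eigenspace.mp (hmem 0 h00)
    rw [heq, b₁] at a₁
    rw [heq, b₂] at a₂
    simp only [Prod.fst_zero, Prod.snd_zero, zero_smul] at a₁ a₂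
    exact Prod.ext ((smul_eq_zero_iff_left hγ0).mp a₁.symm)
      ((smul_eq_zero_iff_left hγ0).mp a₂.symm)
  · have hcc : ∀ {c : ℂ}, ‖c‖ = 1 → conj c ∈ Submonoid.unitSphere ℂ := fun h =>
      mem_sphere_zero_iff_norm.mpr (by rw [RCLike.norm_conj, h])
    obtain ⟨U, hU⟩ := htrans (⟨0, by simp, ⟨conj c₁, hcc hc₁⟩⟩, ⟨0, by simp, ⟨conj c₂, hcc hc₂⟩⟩)
    have hs : ∀ w : ℂ × ℂ, conjPt (mobMap (⟨0, by simp, ⟨conj c₁, hcc hc₁⟩⟩,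
        ⟨0, by simp, ⟨conj c₂, hcc hc₂⟩⟩) (conjPt w)) = (c₁ * w.1, c₂ * w.2) := fun w => by
      simp [conjPt, mobMap, Mob.toFun]
    have hs' : ∀ w ∈ ball (0 : ℂ × ℂ) ε, (c₁ * w.1, c₂ * w.2) ∈ ball (0 : ℂ × ℂ) ε :=
      fun w hw => mk_mem_ball (norm_mul_lt_of_le_one hc₁.le (norm_lt_of_mem_ball hw).1)
        (norm_mul_lt_of_le_one hc₂.le (norm_lt_of_mem_ball hw).2)
    simp only [hs] at hU
    obtain ⟨d₀, e₀⟩ := hU 0 h00 (hs' 0 h00)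
    obtain ⟨d, e⟩ := hU z hz (hs' z hz)
    obtain ⟨d', e'⟩ := hU w hw (hs' w hw)
    simp only [Prod.fst_zero, Prod.snd_zero, mul_zero, Prod.mk_zero_zero] at e₀
    have i₁ := hinner U e₀ e₀
    have i₂ := hinner U e e₀
    have i₃ := hinner U e₀ e'
    rw [hinner U e e']
    rw [h0 0 h00, mul_one] at i₁
    rw [h0' z hz, h0' _ (hs' z hz), mul_one] at i₂
    rw [h0 w hw, h0 _ (hs' w hw), mul_one] at i₃
    -- The rotation fixes `0`, so the normalization gives `|d₀|² = 1`, `d̄ d₀ = 1` and `d̄₀ d' = 1`;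
    -- all multipliers therefore coincide.
    have : conj d * d' = 1 := by
      linear_combination conj d * d' * i₁ - i₂ - conj d * d₀ * i₃
    rw [this, one_mul]
  · obtain ⟨ha₁, ha₂⟩ := norm_lt_of_mem_ball ha
    have hcc : ∀ {c : ℂ}, ‖c‖ < ε → ‖conj c‖ < 1 := fun h => by
      rw [RCLike.norm_conj]; exact h.trans_le hε1
    -- The centre is conjugated so that, in the eigenvalue variable, the map is `discAut a`, with `a
    -- ↦ 0` and `0 ↦ -a`.
    obtain ⟨U, hU⟩ := htrans (⟨conj a.1, hcc ha₁, 1⟩, ⟨conj a.2, hcc ha₂, 1⟩)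
    have hs : ∀ w : ℂ × ℂ, conjPt (mobMap (⟨conj a.1, hcc ha₁, 1⟩, ⟨conj a.2, hcc ha₂, 1⟩)
        (conjPt w)) = (discAut a.1 w.1, discAut a.2 w.2) := fun w => by
      simp [conjPt, mobMap, Mob.toFun, discAut]
    simp only [hs] at hU
    have ea : ((discAut a.1 a.1, discAut a.2 a.2) : ℂ × ℂ) = 0 := by simp [discAut]
    have e0 : ((discAut a.1 (0 : ℂ × ℂ).1, discAut a.2 (0 : ℂ × ℂ).2) : ℂ × ℂ) = -a := by
      simp [discAut, Prod.ext_iff]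
    have hna : -a ∈ ball (0 : ℂ × ℂ) ε := by simpa using ha
    obtain ⟨d₀, e₀⟩ := hU 0 h00 (e0 ▸ hna)
    obtain ⟨d, e⟩ := hU a ha (ea ▸ h00)
    obtain ⟨d', e'⟩ := hU w hw hσ
    rw [e0] at e₀
    rw [ea] at e
    have i₁ := hinner U e e
    have i₂ := hinner U e e'
    have i₃ := hinner U e₀ e
    have i₄ := hinner U e₀ e'
    rw [h0 0 h00, mul_one] at i₁
    rw [h0 _ hσ, mul_one] at i₂
    rw [h0 a ha, h0' _ hna, mul_one] at i₃
    rw [h0 w hw] at i₄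
    -- The relations `d̄₀ d = 1` and `d̄₀ d' ⟨γ (-a), γ (σ w)⟩ = 1`, with `σ` the automorphism,
    -- eliminate the multipliers from `⟨γ a, γ a⟩ = d̄ d` and `⟨γ a, γ w⟩ = d̄ d'`.
    have hd₀ : conj d₀ ≠ 0 := fun h => by simp [h] at i₃
    rw [i₁, i₂]
    refine mul_left_cancel₀ hd₀ ?_
    linear_combination conj d * i₄ - conj d * i₃

end HilbertModule

end Homogeneous

/-! ### Unitary equivalence from equality of Gram kernels -/

section Gram

variable {ι H H' : Type*} [NormedAddCommGroup H] [InnerProductSpace ℂ H] [CompleteSpace H]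
  [NormedAddCommGroup H'] [InnerProductSpace ℂ H'] [CompleteSpace H']

lemma denseRange_linearCombination {K : ι → H} (hK : ∀ h, (∀ i, inner ℂ (K i) h = 0) → h = 0) :
    DenseRange (Finsupp.linearCombination ℂ K) := by
  have h : (LinearMap.range (Finsupp.linearCombination ℂ K)).topologicalClosure = ⊤ := by
    rw [Submodule.topologicalClosure_eq_top_iff, Submodule.eq_bot_iff]
    refine fun x hx => hK x fun i => hx _ ⟨Finsupp.single i 1, by simp⟩
  rw [DenseRange, ← LinearMap.coe_range]
  exact Submodule.dense_iff_topologicalClosure_eq_top.mpr h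

/-- Equal Gram kernels make `∑ cᵢ Kᵢ ↦ ∑ cᵢ K'ᵢ` isometric. Totality makes its domain and its range
dense, so it extends to a unitary. -/
theorem exists_linearIsometryEquiv_of_inner_eq {K : ι → H} {K' : ι → H'}
    (hK : ∀ h, (∀ i, inner ℂ (K i) h = 0) → h = 0)
    (hK' : ∀ h, (∀ i, inner ℂ (K' i) h = 0) → h = 0)
    (hKK' : ∀ i j, inner ℂ (K i) (K j) = inner ℂ (K' i) (K' j)) :
    ∃ U : H ≃ₗᵢ[ℂ] H', ∀ i, U (K i) = K' i := by
  have hd := denseRange_linearCombination hK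
  have hd' := denseRange_linearCombination hK'
  have hn : ∀ x : ι →₀ ℂ, ‖Finsupp.linearCombination ℂ K' ((LinearEquiv.refl ℂ (ι →₀ ℂ)) x)‖ =
      ‖Finsupp.linearCombination ℂ K x‖ := fun x => by
    rw [LinearEquiv.refl_apply, @norm_eq_sqrt_re_inner ℂ, @norm_eq_sqrt_re_inner ℂ]
    simp only [Finsupp.linearCombination_apply, Finsupp.sum, sum_inner, inner_sum,
      inner_smul_left, inner_smul_right, hKK']
  refine ⟨(LinearEquiv.refl ℂ (ι →₀ ℂ)).extendOfIsometry (Finsupp.linearCombination ℂ K)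
    (Finsupp.linearCombination ℂ K') hd hd' hn, fun i => ?_⟩
  have h := LinearEquiv.extendOfIsometry_eq (LinearEquiv.refl ℂ (ι →₀ ℂ))
    (Finsupp.linearCombination ℂ K) (Finsupp.linearCombination ℂ K') hd hd' hn
    (Finsupp.single i 1)
  simpa using h

end Gram

/-! ### The model spaces consist of holomorphic functions -/

section Model

open Metric

variable {l m : ℝ≥0}

lemma modelSpace.kerFun_apply (z w : openBidisc) (v : ℂ) :
    RKHS.kerFun (modelSpace l m) w v z =
      discKernel l (z : ℂ × ℂ).1 (w : ℂ × ℂ).1 * discKernel m (z : ℂ × ℂ).2 (w : ℂ × ℂ).2 * v := by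
  rw [RKHS.kerFun_apply, RKHS.OfKernel.kernel_ofKernel]
  simp [kernel]

lemma modelSpace.inner_kerFun (z w : openBidisc) :
    inner ℂ (RKHS.kerFun (modelSpace l m) z 1) (RKHS.kerFun (modelSpace l m) w 1) =
      discKernel l (z : ℂ × ℂ).1 (w : ℂ × ℂ).1 * discKernel m (z : ℂ × ℂ).2 (w : ℂ × ℂ).2 := by
  rw [RKHS.kerFun_inner, modelSpace.kerFun_apply]
  simp

/-- The elements of the model space as functions on `ℂ²` that vanish off the bidisc. -/
def modelExt (g : modelSpace l m) : ℂ × ℂ → ℂ := Function.extend Subtype.val g 0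

lemma modelExt_apply (g : modelSpace l m) (z : openBidisc) : modelExt g z = g z :=
  Subtype.val_injective.extend_apply _ _ _

lemma modelExt_of_mem (g : modelSpace l m) {z : ℂ × ℂ} (hz : z ∈ openBidisc) :
    modelExt g z = g ⟨z, hz⟩ := modelExt_apply g ⟨z, hz⟩

lemma norm_mul_conj_lt {z w : ℂ} (hz : ‖z‖ < 1) (hw : ‖w‖ < 1) : ‖z * conj w‖ < 1 := by
  rw [norm_mul, RCLike.norm_conj]
  nlinarith [norm_nonneg z, norm_nonneg w]

lemma differentiableAt_discKernel {z w : ℂ} (hz : ‖z‖ < 1) (hw : ‖w‖ < 1) :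
    DifferentiableAt ℂ (fun z => discKernel l z w) z := by
  unfold discKernel
  exact DifferentiableAt.cpow_const (by fun_prop)
    (one_sub_mem_slitPlane (norm_mul_conj_lt hz hw))

lemma continuousAt_discKernel_self {z : ℂ} (hz : ‖z‖ < 1) :
    ContinuousAt (fun z => discKernel l z z) z := by
  unfold discKernel
  exact ContinuousAt.cpow (by fun_prop) continuousAt_const
    (one_sub_mem_slitPlane (norm_mul_conj_lt hz hz))

/-- The parameters `t` for which `t z` is in the bidisc. -/
def slice (z : ℂ × ℂ) : Set ℂ := {t | t • z ∈ openBidisc}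

lemma isOpen_slice (z : ℂ × ℂ) : IsOpen (slice z) :=
  isOpen_openBidisc.preimage (by fun_prop : Continuous fun t : ℂ => t • z)

lemma isPreconnected_slice (z : ℂ × ℂ) : IsPreconnected (slice z) := by
  have hc : Convex ℝ openBidisc := (convex_ball (0 : ℂ) 1).prod (convex_ball (0 : ℂ) 1)
  exact (hc.linear_preimage ((LinearMap.toSpanSingleton ℂ (ℂ × ℂ) z).restrictScalars ℝ)
    ).isPreconnected

lemma zero_mem_slice (z : ℂ × ℂ) : (0 : ℂ) ∈ slice z := by
  change (0 : ℂ) • z ∈ openBidisc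
  rw [zero_smul]
  exact zero_mem_openBidisc

lemma one_mem_slice (z : openBidisc) : (1 : ℂ) ∈ slice z := by
  change (1 : ℂ) • (z : ℂ × ℂ) ∈ openBidisc
  rw [one_smul]
  exact z.2

lemma norm_lt_of_mem_openBidisc {z : ℂ × ℂ} (hz : z ∈ openBidisc) : ‖z.1‖ < 1 ∧ ‖z.2‖ < 1 := by
  simpa only [Set.mem_prod, mem_ball_zero_iff] using hz

/-- Kernel functions are holomorphic on slices and span a dense subspace. Norm convergence is
locally uniform convergence, since `|g z| ≤ ‖g‖ √K(z, z)` and the diagonal of the kernel is locally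
bounded. Holomorphy along complex lines through the origin is all that the continuation arguments
need. -/
lemma differentiableOn_modelExt (g : modelSpace l m) (z : ℂ × ℂ) :
    DifferentiableOn ℂ (fun t : ℂ => modelExt g (t • z)) (slice z) := by
  have hspan : ∀ g ∈ Submodule.span ℂ {RKHS.kerFun (modelSpace l m) x v | (x) (v)},
      DifferentiableOn ℂ (fun t : ℂ => modelExt g (t • z)) (slice z) := fun g hg => by
    induction hg using Submodule.span_induction with
    | mem g hg =>
      obtain ⟨w, v, rfl⟩ := hg
      obtain ⟨hw₁, hw₂⟩ := norm_lt_of_mem_openBidisc w.2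
      have : DifferentiableOn ℂ (fun t : ℂ => discKernel l (t * z.1) (w : ℂ × ℂ).1 *
          discKernel m (t * z.2) (w : ℂ × ℂ).2 * v) (slice z) := fun t ht => by
        obtain ⟨ht₁, ht₂⟩ := norm_lt_of_mem_openBidisc (show t • z ∈ openBidisc from ht)
        have d₁ : DifferentiableAt ℂ (fun t : ℂ => discKernel l (t * z.1) (w : ℂ × ℂ).1) t :=
          (differentiableAt_discKernel (l := l) ht₁ hw₁).comp t
            (differentiableAt_id.mul_const z.1)
        have d₂ : DifferentiableAt ℂ (fun t : ℂ => discKernel m (t * z.2) (w : ℂ × ℂ).2) t :=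
          (differentiableAt_discKernel (l := m) ht₂ hw₂).comp t
            (differentiableAt_id.mul_const z.2)
        exact ((d₁.mul d₂).mul_const v).differentiableWithinAt
      refine this.congr fun t ht => ?_
      rw [modelExt_of_mem _ ht, modelSpace.kerFun_apply]
      rfl
    | zero =>
      refine (differentiableOn_const 0).congr fun t ht => ?_
      rw [modelExt_of_mem _ ht, RKHS.coe_zero]
      rfl
    | add g g' _ _ h h' =>
      refine (h.add h').congr fun t ht => ?_
      simp only [Pi.add_apply, modelExt_of_mem _ ht, RKHS.coe_add]
    | smul c g _ h =>
      refine (h.const_smul c).congr fun t ht => ?_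
      simp only [Pi.smul_apply, modelExt_of_mem _ ht, RKHS.coe_smul]
  have hg : g ∈ closure (Submodule.span ℂ {RKHS.kerFun (modelSpace l m) x v | (x) (v)} :
      Set (modelSpace l m)) := by
    rw [← Submodule.topologicalClosure_coe, RKHS.kerFun_dense]
    trivial
  obtain ⟨G, hG, hlim⟩ := mem_closure_iff_seq_limit.mp hg
  refine TendstoLocallyUniformlyOn.differentiableOn (φ := Filter.atTop)
    (F := fun n t => modelExt (G n) (t • z)) ?_ (Filter.Eventually.of_forall fun n =>
      hspan _ (hG n)) (isOpen_slice z)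
  rw [Metric.tendstoLocallyUniformlyOn_iff]
  intro ε hε t₀ ht₀
  obtain ⟨ht₁, ht₂⟩ := norm_lt_of_mem_openBidisc (show t₀ • z ∈ openBidisc from ht₀)
  let B : ℂ → ℂ := fun t => discKernel l (t * z.1) (t * z.1) * discKernel m (t * z.2) (t * z.2)
  have hB : ContinuousAt B t₀ := by
    refine ContinuousAt.mul ?_ ?_
    · exact ContinuousAt.comp (g := fun z => discKernel l z z) (f := fun t => t * z.1)
        (continuousAt_discKernel_self ht₁) (by fun_prop)
    · exact ContinuousAt.comp (g := fun z => discKernel m z z) (f := fun t => t * z.2)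
        (continuousAt_discKernel_self ht₂) (by fun_prop)
  have hBev : ∀ᶠ t in nhds t₀, ‖B t‖ < ‖B t₀‖ + 1 :=
    hB.norm.eventually_lt continuousAt_const (by linarith)
  set C := √(‖B t₀‖ + 1)
  refine ⟨slice z ∩ {t | ‖B t‖ < ‖B t₀‖ + 1}, mem_nhdsWithin_of_mem_nhds
    (Filter.inter_mem ((isOpen_slice z).mem_nhds ht₀) hBev), ?_⟩
  have hn : Filter.Tendsto (fun n => ‖G n - g‖ * C) Filter.atTop (nhds 0) := by
    simpa using (tendsto_iff_norm_sub_tendsto_zero.mp hlim).mul_const C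
  filter_upwards [hn.eventually (gt_mem_nhds hε)] with n hn t ht
  rw [dist_eq_norm', modelExt_of_mem _ ht.1, modelExt_of_mem _ ht.1, ← Pi.sub_apply,
    ← RKHS.coe_sub]
  refine lt_of_le_of_lt ((RKHS.norm_apply_le _ _).trans ?_) hn
  refine mul_le_mul_of_nonneg_left (Real.sqrt_le_sqrt ?_) (norm_nonneg _)
  rw [RKHS.OfKernel.kernel_ofKernel]
  refine le_trans ?_ (le_of_lt (show ‖B t‖ < ‖B t₀‖ + 1 from ht.2))
  rw [kernel, norm_smul]
  exact mul_le_of_le_one_right (norm_nonneg _) ContinuousLinearMap.norm_id_le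

/-- Two functions that are holomorphic on a slice of the bidisc and that agree near the origin
agree on the slice. -/
lemma eqOn_slice {f g : ℂ → ℂ} {z : ℂ × ℂ} (hf : DifferentiableOn ℂ f (slice z))
    (hg : DifferentiableOn ℂ g (slice z)) {r : ℝ} (hr : 0 < r)
    (h : ∀ t ∈ slice z, ‖t • z‖ < r → f t = g t) : Set.EqOn f g (slice z) := by
  refine (hf.analyticOnNhd (isOpen_slice z)).eqOn_of_preconnected_of_eventuallyEq
    (hg.analyticOnNhd (isOpen_slice z)) (isPreconnected_slice z) (zero_mem_slice z) ?_
  have hc : Continuous fun t : ℂ => ‖t • z‖ := by fun_prop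
  filter_upwards [(isOpen_slice z).mem_nhds (zero_mem_slice z),
    hc.continuousAt.eventually_lt (continuousAt_const (y := r)) (by simpa using hr)] with t ht ht'
    using h t ht ht'

/-- By the reproducing property `g` vanishes near the origin, hence along each complex line through
it. -/
lemma modelSpace.eq_zero_of_inner_kerFun_eq_zero {r : ℝ} (hr : 0 < r) {g : modelSpace l m}
    (h : ∀ z : openBidisc, ‖(z : ℂ × ℂ)‖ < r → inner ℂ (RKHS.kerFun (modelSpace l m) z 1) g = 0) :
    g = 0 := by
  refine RKHS.ext fun z => ?_
  have h1 := eqOn_slice (differentiableOn_modelExt g z) (differentiableOn_const (0 : ℂ)) hr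
    (fun t ht htr => by
      have := h ⟨t • z, ht⟩ htr
      rw [RKHS.kerFun_inner] at this
      rw [modelExt_of_mem _ ht]
      simpa using this) (one_mem_slice z)
  simp only [one_smul, modelExt_apply] at h1
  rw [h1, RKHS.coe_zero, Pi.zero_apply]

end Model

/-! ### Homogeneous modules -/

section Main

open Metric

variable {H : Type*} [NormedAddCommGroup H] [InnerProductSpace ℂ H]
  {M : HilbertModule H}

/-- A unitary that intertwines, at the points near the origin, the module action with pointwise
multiplication is an isomorphism onto the model. -/
lemma HilbertModule.act_apply_of_small {l m : ℝ≥0} {U : H ≃ₗᵢ[ℂ] modelSpace l m} {r : ℝ}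
    (hr : 0 < r) (h : ∀ (f : algebra) (x : H) (z : openBidisc), ‖(z : ℂ × ℂ)‖ < r →
      U (M.act f x) z = (f : C(closedBidisc, ℂ)) (incl z) * U x z)
    (f : algebra) (x : H) (z : openBidisc) :
    U (M.act f x) z = (f : C(closedBidisc, ℂ)) (incl z) * U x z := by
  let A : Subalgebra ℂ algebra :=
    { carrier := {f | ∀ (x : H) (z : openBidisc),
        U (M.act f x) z = (f : C(closedBidisc, ℂ)) (incl z) * U x z}
      mul_mem' := fun {f g} hf hg x z => by
        rw [map_mul, mul_apply_eq_comp, hf, hg]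
        simp [mul_assoc]
      add_mem' := fun {f g} hf hg x z => by
        rw [map_add, add_apply, map_add, RKHS.coe_add, Pi.add_apply, hf, hg]
        simp [add_mul]
      algebraMap_mem' := fun c x z => by
        rw [AlgHom.commutes, Algebra.algebraMap_eq_smul_one, smul_apply, map_smul, RKHS.coe_smul]
        rfl }
  have hA : IsClosed (A : Set algebra) := by
    have : (A : Set algebra) = ⋂ (x : H) (z : openBidisc), {f | U (M.act f x) z =
        (f : C(closedBidisc, ℂ)) (incl z) * U x z} := by
      ext f
      simp only [Set.mem_iInter]
      rfl
    rw [this]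
    refine isClosed_iInter fun x => isClosed_iInter fun z => isClosed_eq
      ((RKHS.continuous_eval z).comp (U.continuous.comp (M.continuous_act x))) ?_
    exact (((continuous_eval_const (incl z)).comp continuous_subtype_val).mul continuous_const)
  -- For a coordinate, both sides are holomorphic along the slice through `z` and agree near `0`;
  -- the closed subalgebra argument handles general `f`.
  have hcoord : ∀ (c : algebra) (p : ℂ × ℂ →L[ℂ] ℂ),
      (∀ z, (c : C(closedBidisc, ℂ)) z = p z) → c ∈ A := fun c p hc x z => by
    have h1 := eqOn_slice (z := z) (f := fun t => modelExt (U (M.act c x)) (t • (z : ℂ × ℂ)))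
      (g := fun t => p (t • (z : ℂ × ℂ)) * modelExt (U x) (t • (z : ℂ × ℂ)))
      (differentiableOn_modelExt _ _)
      (DifferentiableOn.mul (by fun_prop) (differentiableOn_modelExt _ _)) hr
      (fun t ht htr => by
        rw [modelExt_of_mem _ ht, modelExt_of_mem _ ht, h c x ⟨_, ht⟩ htr, hc]
        rfl) (one_mem_slice z)
    simp only [one_smul, modelExt_apply] at h1
    rw [h1, hc]
    rfl
  have htop := eq_top_of_coord_mem hA (hcoord coord₁ (.fst ℂ ℂ ℂ) fun _ => rfl)
    (hcoord coord₂ (.snd ℂ ℂ ℂ) fun _ => rfl)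
  exact (htop ▸ Algebra.mem_top : f ∈ A) x z

end Main

end Bidisc

end

theorem theorem3 {H : Type*} [NormedAddCommGroup H] [InnerProductSpace ℂ H] [CompleteSpace H]
    (M : Bidisc.HilbertModule H) (hB : M.InB₁) (hM : M.IsHomogeneous) :
    ∃ l m : ℝ≥0, 0 < l ∧ 0 < m ∧ M.IsomorphicToModel l m := by
  obtain ⟨l, m, hl, hm, r, hr, hr1, γ, hγ⟩ := Bidisc.HilbertModule.exists_frame_inner_eq hB hM
  refine ⟨l, m, hl, hm, ?_⟩
  -- Only points near the origin serve as indices, since the frame exists only there. The frame is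
  -- evaluated at conjugated points because the kernel function at `z` corresponds to the eigenvalue
  -- `z̄`.
  let ι := {z : Bidisc.openBidisc // ‖(z : ℂ × ℂ)‖ < r}
  have hι : ∀ i : ι, Bidisc.conjPt i.1 ∈ Metric.ball (0 : ℂ × ℂ) r := fun i => by
    rw [mem_ball_zero_iff, Bidisc.norm_conjPt]
    exact i.2
  obtain ⟨U, hU⟩ := Bidisc.exists_linearIsometryEquiv_of_inner_eq
    (K := fun i : ι => γ (Bidisc.conjPt i.1))
    (K' := fun i : ι => RKHS.kerFun (Bidisc.modelSpace l m) i.1 1)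
    (fun h hh => by
      refine Bidisc.CowenDouglas.eq_zero_of_eventually_inner_eq_zero Bidisc.isOpen_openBidisc
        Bidisc.isPreconnected_openBidisc hB Bidisc.zero_mem_openBidisc ?_
      filter_upwards [Metric.ball_mem_nhds (0 : ℂ × ℂ) hr] with w hw x hx
      change x ∈ M.eigenspace w at hx
      rw [(hγ w hw).1] at hx
      obtain ⟨c, rfl⟩ := Submodule.mem_span_singleton.mp hx
      have hw' : w ∈ Bidisc.openBidisc := by
        rw [Bidisc.openBidisc_eq_ball]
        exact Metric.ball_subset_ball hr1 hw
      have := hh ⟨⟨Bidisc.conjPt w, Bidisc.conjPt_mem_openBidisc hw'⟩, by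
        rw [Bidisc.norm_conjPt]
        exact mem_ball_zero_iff.mp hw⟩
      rw [Bidisc.conjPt_conjPt] at this
      rw [inner_smul_right, ← inner_conj_symm, this, map_zero, mul_zero])
    (fun g hg => Bidisc.modelSpace.eq_zero_of_inner_kerFun_eq_zero hr fun z hz => hg ⟨z, hz⟩)
    (fun i j => by
      rw [(hγ _ (hι i)).2 _ (hι j), Bidisc.modelSpace.inner_kerFun]
      simp [Bidisc.conjPt, Bidisc.discKernel, mul_comm])
  refine ⟨U, Bidisc.HilbertModule.act_apply_of_small hr fun f x z hz => ?_⟩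
  -- Reproducing property carried back through `U`: near the origin, evaluation of `U y` is pairing
  -- of `y` with an eigenvector, on which the module action is known.
  have hval : ∀ y, U y z = inner ℂ (γ (Bidisc.conjPt z)) y := fun y => by
    rw [← U.inner_map_map, hU ⟨z, hz⟩, RKHS.kerFun_inner]
    simp
  rw [hval, hval]
  exact Bidisc.HilbertModule.inner_act_of_mem_eigenspace z
    ((hγ _ (hι ⟨z, hz⟩)).1 ▸ Submodule.mem_span_singleton_self _) f x
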